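/- Let $d\ge 1$, $n_G\ge 2$, $n_e\ge 1$ be integers and $X=[0,1]^d$. Let $G$ be the regular grid of $n_G^d$ points of $X$ with step $\epsilon=1/(n_G-1)$, and call faces of the grid the cubes of edge $\epsilon$ with vertices in $G$ and all their faces of dimension $0,\dots,d$; $\mathcal F_i(G)$ is the set of the $i$-dimensional ones, $\mathcal V(F)$ the set of vertices of $F$. Let $\mathcal M:X\to\{-1,0,+1\}$ be a labelling (in the application $\mathcal M$ is $0$ on a hypersurface $M$ and $\pm1$ on the two parts of $X$ that $M$ separates) that does not vanish at any grid point. For every edge $[v_-,v_+]$ of the grid with $\mathcal M(v_-)=-1$ and $\mathcal M(v_+)=+1$ let a boundary point $$b_M([v_-,v_+])=v_-+\frac{i+1/2}{n_e}(v_+-v_-)$$ be chosen, where $i\in\{0,\dots,n_e-1\}$ is such that $\mathcal M\left(v_-+\frac{i}{n_e}(v_+-v_-)\right)=-1$ and $\mathcal M\left(v_-+\frac{i+1}{n_e}(v_+-v_-)\right)=+1$ (it is supposed that such an $i$ exists). For a face $F$ of the grid let $B_M(F)$ be the set of the boundary points on the edges of $F$ and $\bar B_M(F)$ its barycentre. Write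 $[S]$ for the convex hull of $S$. The grid c-resistar $[B_G]^\star$ is the union of the simplices $[\{\bar B_M(F_1),\dots,\bar B_M(F_{d-1}),\bar B_M(C)\}]$ over all $C\in\mathcal F_d(G)$ with $B_M(C)\ne\emptyset$ and all chains $F_1\subset\dots\subset F_{d-1}\subset C$ with $F_i\in\mathcal F_i(G)$ and $B_M(F_1)\neq\emptyset$. Its boundary $\partial[B_G]^\star$ is the union of the facets of these simplices that are not shared with another of these simplices. Let $\mathcal D(B_G,G)$ be the set of connected components of the union of all faces $F$ of the grid with $B_M(F)=\emptyset$. For $D\in\mathcal D(B_G,G)$, the classification set of $D$ is $$[B_G]^{\mathcal D\star}(D)=\bigcup_{C\in\mathcal F_d(G)}[B_M(C)]^{\mathcal D\star}(D\cap C),$$ where $[B_M(C)]^{\mathcal D\star}(D\cap C)$ is $\emptyset$ if $D\cap C=\emptyset$, is $C$ if $D\cap C=C$, and otherwise is the union of the polytopes $$\left[\mathcal V(F_h)\cup\{\bar B_M(F_{h+1}),\dots,\bar B_M(F_{d-1}),\bar B_M(C)\}\right]$$ over all $0\le h\le d-1$ and all chains $F_h\subset F_{h+1}\subset\dots\subset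 F_{d-1}\subset F_d=C$ with $F_i\in\mathcal F_i(G)$, $F_h\subset D\cap C$ and $B_M(F_{h+1})\ne\emptyset$. Proposition. For every $D\in\mathcal D(B_G,G)$: $D\subset[B_G]^{\mathcal D\star}(D)$; the set $[B_G]^{\mathcal D\star}(D)$ is connected; and its boundary in $X-\partial X$ is $$[B_G]^{\mathcal D\star}(D)\cap\left([B_G]^\star-\partial[B_G]^\star\right).$$ -/

import Mathlib

noncomputable section

open Set

namespace CResistar

/-- The ambient space of the domain; only its topology and its affine structure are used. -/
abbrev E (d : ℕ) : Type := Fin d → ℝ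

/-- The compact domain `X = [0,1]^d`. -/
def X (d : ℕ) : Set (E d) := Set.Icc 0 1

/-- The distance `ε = 1 / (n - 1)` between adjacent points of the grid with `n` points per axis. -/
def eps (n : ℕ) : ℝ := 1 / ((n : ℝ) - 1)

/-- A cube, or a face of a cube, of the regular grid with `n` points per axis in `[0,1]^d`: the
product of the intervals `[base i * ε, (base i + 1) * ε]` for `i ∈ dirs` and of the points
`base i * ε` for `i ∉ dirs`. -/
structure GridFace (d n : ℕ) where
  base : Fin d → Fin n
  dirs : Finset (Fin d)
  bound : ∀ i ∈ dirs, (base i : ℕ) + 1 < n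

namespace GridFace

variable {d n : ℕ}

/-- The dimension of a face. The grid cubes are the faces of dimension `d`, the grid points those
of dimension `0`, the edges those of dimension `1`. -/
def dim (F : GridFace d n) : ℕ := F.dirs.card

/-- The smallest corner of a face. -/
def lo (F : GridFace d n) : E d := fun i => ((F.base i : ℕ) : ℝ) * eps n

open Classical in
/-- The largest corner of a face. -/
def hi (F : GridFace d n) : E d :=
  fun i => (((F.base i : ℕ) : ℝ) + if i ∈ F.dirs then 1 else 0) * eps n

/-- The face as a set of points. -/
def toSet (F : GridFace d n) : Set (E d) := Set.Icc F.lo F.hi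

/-- The vertices `𝒱(F)` of a face. -/
def vertices (F : GridFace d n) : Set (E d) := {v | ∀ i, v i = F.lo i ∨ v i = F.hi i}

theorem finite_gridFace : Finite (GridFace d n) :=
  Finite.of_injective (fun F : GridFace d n => (F.base, F.dirs)) (by
    rintro ⟨a, b, h⟩ ⟨a', b', h'⟩ hab
    simp only [Prod.mk.injEq] at hab
    obtain ⟨rfl, rfl⟩ := hab
    rfl)

theorem finite_vertices (F : GridFace d n) : F.vertices.Finite := by
  refine (Set.Finite.pi' (t := fun i => ({F.lo i, F.hi i} : Set ℝ))
    (fun i => Set.toFinite _)).subset ?_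
  intro v hv i
  simpa using hv i

end GridFace

/-- The barycentre of a finite set of points. -/
def barycentre {d : ℕ} (B : Set (E d)) : E d := (B.ncard : ℝ)⁻¹ • ∑ᶠ x ∈ B, x

/-- `b u v` is a boundary point of the edge `[u, v]`, for all edges of the grid whose end
points are labelled `𝓜 u = -1` and `𝓜 v = +1`, each edge being divided into `ne` equal parts. -/
def IsBoundaryPointMap {d : ℕ} (n ne : ℕ) (𝓜 : E d → SignType) (b : E d → E d → E d) : Prop :=
  ∀ e : GridFace d n, e.dim = 1 → ∀ u ∈ e.vertices, ∀ v ∈ e.vertices,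
    𝓜 u = -1 → 𝓜 v = 1 →
      ∃ i < ne,
        𝓜 (u + ((i : ℝ) / ne) • (v - u)) = -1 ∧
        𝓜 (u + (((i : ℝ) + 1) / ne) • (v - u)) = 1 ∧
        b u v = u + (((i : ℝ) + 1 / 2) / ne) • (v - u)

section Resistar

variable {d n : ℕ} (𝓜 : E d → SignType) (b : E d → E d → E d)

/-- The set `B_M(F)` of the boundary points defined on the edges of `F`. -/
def boundaryPoints (F : GridFace d n) : Set (E d) :=
  {p | ∃ e : GridFace d n, e.dim = 1 ∧ e.toSet ⊆ F.toSet ∧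
    ∃ u ∈ e.vertices, ∃ v ∈ e.vertices, 𝓜 u = -1 ∧ 𝓜 v = 1 ∧ p = b u v}

theorem finite_boundaryPoints (F : GridFace d n) : (boundaryPoints 𝓜 b F).Finite := by
  have := GridFace.finite_gridFace (d := d) (n := n)
  have h : (⋃ e : GridFace d n, Set.image2 b e.vertices e.vertices).Finite :=
    Set.finite_iUnion fun e => (e.finite_vertices).image2 b e.finite_vertices
  refine h.subset ?_
  rintro p ⟨e, -, -, v, hv, w, hw, -, -, rfl⟩
  exact Set.mem_iUnion.2 ⟨e, Set.mem_image2_of_mem hv hw⟩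

/-- `F h ⊂ F (h + 1) ⊂ ⋯ ⊂ F d = C` is a chain of faces of the cube `C` with `dim (F i) = i`
(the values of `F` outside `h, …, d` play no role). -/
def IsFlag (C : GridFace d n) (h : ℕ) (F : ℕ → GridFace d n) : Prop :=
  F d = C ∧ (∀ i, h ≤ i → i ≤ d → (F i).dim = i) ∧
    ∀ i, h ≤ i → i < d → (F i).toSet ⊆ (F (i + 1)).toSet

/-- The vertex sets `{B̄_M(F₁), …, B̄_M(F_{d-1}), B̄_M(C)}` of the simplices of the c-resistar in
the cube `C`, where `B_M(F₁) ≠ ∅`. -/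
def resistarSimplices (C : GridFace d n) : Set (Set (E d)) :=
  {S | ∃ F : ℕ → GridFace d n, IsFlag C 1 F ∧ (boundaryPoints 𝓜 b (F 1)).Nonempty ∧
    S = (fun i => barycentre (boundaryPoints 𝓜 b (F i))) '' Set.Icc 1 d}

variable (n) in
/-- The vertex sets of the simplices of the c-resistar on the grid. -/
def gridResistarSimplices : Set (Set (E d)) :=
  {S | ∃ C : GridFace d n, C.dim = d ∧ (boundaryPoints 𝓜 b C).Nonempty ∧
    S ∈ resistarSimplices 𝓜 b C}

variable (n) in
/-- The c-resistar `[B_G]^⋆` on the grid. -/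
def gridResistar : Set (E d) := ⋃ S ∈ gridResistarSimplices n 𝓜 b, convexHull ℝ S

/-- The boundary of the surface formed by a set of simplices of the same dimension, given by their
vertex sets: the union of the facets of the simplices that are not shared with another simplex. -/
def complexBoundary (𝒮 : Set (Set (E d))) : Set (E d) :=
  {x | ∃ S ∈ 𝒮, ∃ p ∈ S, (∀ S' ∈ 𝒮, S \ {p} ⊆ S' → S' = S) ∧ x ∈ convexHull ℝ (S \ {p})}

variable (n) in
/-- The boundary `∂[B_G]^⋆` of the c-resistar on the grid. -/
def gridResistarBoundary : Set (E d) := complexBoundary (gridResistarSimplices n 𝓜 b)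

variable (n) in
/-- The union of the faces in `ℋ(B_G, G)`, the faces of the grid without boundary points. -/
def emptyFaces : Set (E d) :=
  ⋃ F ∈ {F : GridFace d n | boundaryPoints 𝓜 b F = ∅}, F.toSet

variable (n) in
/-- The connected components `𝒟(B_G, G)` of the faces without boundary points. -/
def components : Set (Set (E d)) :=
  {D | ∃ x ∈ emptyFaces n 𝓜 b, D = connectedComponentIn (emptyFaces n 𝓜 b) x}

/-- The union of the polytopes `[𝒱(F_h) ∪ {B̄_M(F_{h+1}), …, B̄_M(F_{d-1}), B̄_M(C)}]` in the cube
`C`, where `0 ≤ h ≤ d - 1`, `F_h ⊂ D` and `B_M(F_{h+1}) ≠ ∅`. -/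
def polytopeUnion (C : GridFace d n) (D : Set (E d)) : Set (E d) :=
  {x | ∃ h < d, ∃ F : ℕ → GridFace d n, IsFlag C h F ∧ (F h).toSet ⊆ D ∧
    (boundaryPoints 𝓜 b (F (h + 1))).Nonempty ∧
    x ∈ convexHull ℝ ((F h).vertices ∪
      (fun i => barycentre (boundaryPoints 𝓜 b (F i))) '' Set.Icc (h + 1) d)}

open Classical in
/-- The classification set `[B_M(C)]^{𝒟⋆}(D)` in the cube `C`, for `D ⊂ C`. -/
def cubeClassificationSet (C : GridFace d n) (D : Set (E d)) : Set (E d) :=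
  if D = ∅ then ∅ else if D = C.toSet then C.toSet else polytopeUnion 𝓜 b C D

variable (n) in
/-- The classification set `[B_G]^{𝒟⋆}(D)` on the grid. -/
def gridClassificationSet (D : Set (E d)) : Set (E d) :=
  ⋃ C ∈ {C : GridFace d n | C.dim = d}, cubeClassificationSet 𝓜 b C (D ∩ C.toSet)

end Resistar

end CResistar

end

noncomputable section

open Set

namespace CResistar

/-! Call a face mixed when its vertices carry both labels. No grid point is labelled 0, so the mixed
faces are those with boundary points (`boundaryPoints_nonempty_iff`), and the barycentre of these
points lies in the relative interior of the face (`centre_mem_relint`). Hence a point of a mixed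
face other than its centre can be projected radially from the centre onto a proper face. Iterating
this ends either at a centre or in a non-mixed face. The end point depends only on the starting
point, because each point lies in the relative interior of just one face (`Retracts.unique`).

A point of the resistar ends at the centre of a mixed face, which lies in no non-mixed face
(`gridResistar_retracts`). A point of the classification set of `D` that is off the resistar ends in
`D` (`mem_gridResistar_or_retracts`). So classification sets of distinct components meet only on the
resistar. They are closed, finitely many, and cover the domain, so a point of one of them that is
inside the domain and off the resistar is interior to it (`mem_interior_of_notMem_gridResistar`).

Conversely, a point of the resistar lies in a simplex whose chain starts at a mixed edge. All grid
points of `D` have the same label (`component_sign`), so an end of that edge is outside `D`. Points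
slightly moved towards this end retract to it and therefore leave the classification set
(`notMem_interior_of_mem_gridResistar`).

The combinatorial boundary of the resistar is its part on the boundary of the domain. Inside the
domain every facet of a simplex is shared (`notMem_interior_of_mem_gridResistarBoundary`). On the
boundary, every point of the resistar lies on an unshared facet (`mem_gridResistarBoundary`).
Connectedness holds because each piece of the classification set is convex and meets `D`, which it
contains. -/

theorem eps_pos {n : ℕ} (hn : 2 ≤ n) : 0 < eps n := by
  have : (2 : ℝ) ≤ n := by exact_mod_cast hn
  unfold eps
  apply one_div_pos.2
  linarith

theorem sub_one_mul_eps {n : ℕ} (hn : 2 ≤ n) : ((n : ℝ) - 1) * eps n = 1 := by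
  have : (2 : ℝ) ≤ n := by exact_mod_cast hn
  unfold eps
  rw [mul_one_div_cancel]
  linarith

/-! ### Combinatorics and convex geometry of the grid faces -/

namespace GridFace

variable {d n : ℕ}

@[ext]
theorem ext' {F G : GridFace d n} (hb : ∀ i, (F.base i : ℕ) = G.base i) (hd : F.dirs = G.dirs) :
    F = G := by
  obtain ⟨a, s, h⟩ := F
  obtain ⟨a', s', h'⟩ := G
  have : a = a' := funext fun i => Fin.ext (hb i)
  subst this
  simp only at hd
  subst hd
  rfl

/-- The length of a face in a direction, in grid steps. -/
def len (F : GridFace d n) (i : Fin d) : ℕ := if i ∈ F.dirs then 1 else 0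

theorem len_of_mem {F : GridFace d n} {i : Fin d} (h : i ∈ F.dirs) : F.len i = 1 := if_pos h

theorem len_of_notMem {F : GridFace d n} {i : Fin d} (h : i ∉ F.dirs) : F.len i = 0 := if_neg h

theorem lo_apply (F : GridFace d n) (i : Fin d) : F.lo i = ((F.base i : ℕ) : ℝ) * eps n := rfl

theorem hi_apply (F : GridFace d n) (i : Fin d) :
    F.hi i = (((F.base i : ℕ) : ℝ) + (F.len i : ℕ)) * eps n := by
  unfold hi len
  split_ifs <;> simp

theorem hi_of_mem {F : GridFace d n} {i : Fin d} (h : i ∈ F.dirs) :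
    F.hi i = (((F.base i : ℕ) : ℝ) + 1) * eps n := by
  rw [hi_apply, len_of_mem h, Nat.cast_one]

theorem hi_of_notMem {F : GridFace d n} {i : Fin d} (h : i ∉ F.dirs) :
    F.hi i = F.lo i := by
  rw [hi_apply, len_of_notMem h, lo_apply, Nat.cast_zero, add_zero]

/-- Inclusion of faces is encoded by inequalities between grid indices, so that incidence questions
become integer arithmetic; `toSet_subset_iff` is the link with the point sets. -/
instance : PartialOrder (GridFace d n) where
  le F G := ∀ i, (G.base i : ℕ) ≤ F.base i ∧ (F.base i : ℕ) + F.len i ≤ G.base i + G.len i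
  le_refl F i := ⟨le_rfl, le_rfl⟩
  le_trans F G H h h' i := ⟨(h' i).1.trans (h i).1, (h i).2.trans (h' i).2⟩
  le_antisymm F G h h' := by
    have hb : ∀ i, (F.base i : ℕ) = G.base i := fun i => le_antisymm (h' i).1 (h i).1
    refine ext' hb ?_
    ext i
    have h1 := (h i).2
    have h2 := (h' i).2
    have h3 := hb i
    by_cases hF : i ∈ F.dirs <;> by_cases hG : i ∈ G.dirs <;>
      simp [len, hF, hG] at h1 h2 ⊢ <;> omega

theorem le_def {F G : GridFace d n} : F ≤ G ↔
    ∀ i, (G.base i : ℕ) ≤ F.base i ∧ (F.base i : ℕ) + F.len i ≤ G.base i + G.len i := Iff.rfl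

theorem len_le_one (F : GridFace d n) (i : Fin d) : F.len i ≤ 1 := by
  unfold len; split_ifs <;> simp

theorem base_add_len_lt (F : GridFace d n) (i : Fin d) : (F.base i : ℕ) + F.len i < n := by
  by_cases h : i ∈ F.dirs
  · rw [len_of_mem h]; exact F.bound i h
  · rw [len_of_notMem h]; exact (F.base i).2

theorem dirs_subset {F G : GridFace d n} (h : F ≤ G) : F.dirs ⊆ G.dirs := by
  intro i hi
  by_contra hG
  have := h i
  rw [len_of_mem hi, len_of_notMem hG] at this
  omega

theorem base_eq_of_mem {F G : GridFace d n} (h : F ≤ G) {i : Fin d} (hi : i ∈ F.dirs) :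
    (F.base i : ℕ) = G.base i := by
  have := h i
  rw [len_of_mem hi, len_of_mem (dirs_subset h hi)] at this
  omega

theorem base_eq_of_notMem {F G : GridFace d n} (h : F ≤ G) {i : Fin d} (hi : i ∉ G.dirs) :
    (F.base i : ℕ) = G.base i := by
  have := h i
  rw [len_of_notMem hi] at this
  omega

theorem base_eq_or {F G : GridFace d n} (h : F ≤ G) (i : Fin d) :
    (F.base i : ℕ) = G.base i ∨ (F.base i : ℕ) = G.base i + 1 := by
  have := h i
  have := G.len_le_one i
  omega

theorem dim_le {F G : GridFace d n} (h : F ≤ G) : F.dim ≤ G.dim :=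
  Finset.card_le_card (dirs_subset h)

theorem eq_of_le_of_dim_le {F G : GridFace d n} (h : F ≤ G) (hd : G.dim ≤ F.dim) : F = G := by
  have hs : F.dirs = G.dirs := Finset.eq_of_subset_of_card_le (dirs_subset h) hd
  refine ext' (fun i => ?_) hs
  by_cases hi : i ∈ F.dirs
  · exact base_eq_of_mem h hi
  · exact base_eq_of_notMem h (hs ▸ hi)

theorem lo_le_hi (hn : 2 ≤ n) (F : GridFace d n) : F.lo ≤ F.hi := by
  intro i
  rw [lo_apply, hi_apply]
  have := eps_pos hn
  gcongr
  simp

theorem lo_mem (hn : 2 ≤ n) (F : GridFace d n) : F.lo ∈ F.toSet := ⟨le_rfl, F.lo_le_hi hn⟩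

theorem toSet_subset_iff (hn : 2 ≤ n) {F G : GridFace d n} : F.toSet ⊆ G.toSet ↔ F ≤ G := by
  have he := eps_pos hn
  unfold toSet
  rw [Set.Icc_subset_Icc_iff (F.lo_le_hi hn), Pi.le_def, Pi.le_def, ← forall_and, le_def]
  refine forall_congr' fun i => ?_
  rw [lo_apply, lo_apply, hi_apply, hi_apply, mul_le_mul_iff_left₀ he, mul_le_mul_iff_left₀ he]
  norm_cast

theorem isClosed_toSet (F : GridFace d n) : IsClosed F.toSet := isClosed_Icc

theorem convex_toSet (F : GridFace d n) : Convex ℝ F.toSet := convex_Icc _ _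

theorem mem_toSet {F : GridFace d n} {x : E d} :
    x ∈ F.toSet ↔ ∀ i, F.lo i ≤ x i ∧ x i ≤ F.hi i := by
  unfold toSet
  rw [Set.mem_Icc, Pi.le_def, Pi.le_def, forall_and]

theorem toSet_subset_X (hn : 2 ≤ n) (F : GridFace d n) : F.toSet ⊆ X d := by
  have he := eps_pos hn
  intro x hx
  rw [mem_toSet] at hx
  refine ⟨fun i => le_trans ?_ (hx i).1, fun i => (hx i).2.trans ?_⟩
  · rw [lo_apply]
    simp only [Pi.zero_apply]
    positivity
  · rw [hi_apply, Pi.one_apply, ← sub_one_mul_eps hn]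
    have h : ((F.base i : ℕ) : ℝ) + (F.len i : ℕ) + 1 ≤ n := by exact_mod_cast F.base_add_len_lt i
    gcongr
    linarith

/-- The relative interior of a face. -/
def relint (F : GridFace d n) : Set (E d) :=
  {x | ∀ i, (i ∈ F.dirs → F.lo i < x i ∧ x i < F.hi i) ∧ (i ∉ F.dirs → x i = F.lo i)}

theorem relint_subset (hn : 2 ≤ n) (F : GridFace d n) : F.relint ⊆ F.toSet := by
  intro x hx
  rw [mem_toSet]
  intro i
  by_cases hi : i ∈ F.dirs
  · exact ⟨((hx i).1 hi).1.le, ((hx i).1 hi).2.le⟩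
  · rw [(hx i).2 hi]
    exact ⟨le_rfl, F.lo_le_hi hn i⟩

/-- No grid coordinate lies strictly between two consecutive ones, so in each direction the interval
of `G` swallows the whole interval of `F` as soon as it contains an interior point of it. The
relative interiors thus partition the domain. -/
theorem le_of_mem_relint (hn : 2 ≤ n) {F G : GridFace d n} {x : E d} (hx : x ∈ F.relint)
    (hG : x ∈ G.toSet) : F ≤ G := by
  have he := eps_pos hn
  rw [mem_toSet] at hG
  intro i
  have h := hx i
  have h' := hG i
  rw [lo_apply, hi_apply] at h'
  by_cases hi : i ∈ F.dirs
  · have h1 := h.1 hi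
    rw [lo_apply, hi_apply] at h1
    rw [len_of_mem hi] at h1 ⊢
    have h2 := lt_of_mul_lt_mul_right (h'.1.trans_lt h1.2) he.le
    have h3 := lt_of_mul_lt_mul_right (h1.1.trans_le h'.2) he.le
    norm_cast at h2 h3
    omega
  · rw [h.2 hi, lo_apply] at h'
    rw [len_of_notMem hi]
    have h2 := le_of_mul_le_mul_right h'.1 he
    have h3 := le_of_mul_le_mul_right h'.2 he
    norm_cast at h2 h3

theorem eq_of_mem_relint (hn : 2 ≤ n) {F G : GridFace d n} {x : E d} (hx : x ∈ F.relint)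
    (hG : x ∈ G.relint) : F = G :=
  le_antisymm (le_of_mem_relint hn hx (relint_subset hn _ hG))
    (le_of_mem_relint hn hG (relint_subset hn _ hx))

/-- The base indices are the integer parts of `x i / eps n`; the directions are the coordinates that
are not multiples of the step. -/
theorem exists_mem_relint (hn : 2 ≤ n) {x : E d} (hx : x ∈ X d) :
    ∃ F : GridFace d n, x ∈ F.relint := by
  have he := eps_pos hn
  have key : ∀ i, ∃ m : Fin n, (x i = (m : ℕ) * eps n) ∨
      ((m : ℕ) + 1 < n ∧ (m : ℕ) * eps n < x i ∧ x i < ((m : ℕ) + 1 : ℝ) * eps n) := by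
    intro i
    have h0 : 0 ≤ x i := hx.1 i
    have h1 : x i ≤ 1 := hx.2 i
    have hq : 0 ≤ x i / eps n := by positivity
    have hf := Nat.floor_le hq
    have hl := Nat.lt_floor_add_one (x i / eps n)
    rw [le_div_iff₀ he] at hf
    rw [div_lt_iff₀ he] at hl
    have hlt : ((⌊x i / eps n⌋₊ : ℕ) : ℝ) ≤ (n : ℝ) - 1 := by
      rw [← mul_le_mul_iff_left₀ he, sub_one_mul_eps hn]
      exact hf.trans h1
    have hlt' : ⌊x i / eps n⌋₊ < n := by
      have : ((⌊x i / eps n⌋₊ : ℕ) : ℝ) < n := by linarith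
      exact_mod_cast this
    refine ⟨⟨_, hlt'⟩, ?_⟩
    rcases hf.eq_or_lt with h | h
    · exact Or.inl h.symm
    · refine Or.inr ⟨?_, h, hl⟩
      have h2 := h.trans_le (h1.trans_eq (sub_one_mul_eps hn).symm)
      have h3 := lt_of_mul_lt_mul_right h2 he.le
      have h4 : ((⌊x i / eps n⌋₊ : ℕ) : ℝ) + 1 < n := by linarith
      exact_mod_cast h4
  choose m hm using key
  classical
  refine ⟨⟨m, Finset.univ.filter fun i => x i ≠ (m i : ℕ) * eps n, fun i hi => ?_⟩, fun i => ?_⟩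
  · simp only [Finset.mem_filter, Finset.mem_univ, true_and] at hi
    exact ((hm i).resolve_left hi).1
  · refine ⟨fun hi => ?_, fun hi => ?_⟩
    · rw [hi_of_mem hi]
      simp only [Finset.mem_filter, Finset.mem_univ, true_and] at hi
      exact ((hm i).resolve_left hi).2
    · simpa [lo_apply] using hi

/-- The face between `F` and `G` with directions `S`. -/
def interp (F G : GridFace d n) (S : Finset (Fin d)) (hS : S ⊆ G.dirs) : GridFace d n where
  base j := if j ∈ S then G.base j else F.base j
  dirs := S
  bound i hi := by rw [if_pos hi]; exact G.bound i (hS hi)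

theorem le_interp {F G : GridFace d n} (h : F ≤ G) {S : Finset (Fin d)} (hS : S ⊆ G.dirs)
    (hF : F.dirs ⊆ S) : F ≤ interp F G S hS := by
  intro i
  have := h i
  by_cases hi : i ∈ S
  · simpa [interp, len, hi, hS hi] using h i
  · have hi' : i ∉ F.dirs := fun h => hi (hF h)
    simp [interp, len, hi, hi']

theorem interp_le {F G : GridFace d n} (h : F ≤ G) {S : Finset (Fin d)} (hS : S ⊆ G.dirs)
    (hF : F.dirs ⊆ S) : interp F G S hS ≤ G := by
  intro i
  by_cases hi : i ∈ S
  · simp [interp, len, hi, hS hi]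
  · have hi' : i ∉ F.dirs := fun h => hi (hF h)
    simpa [interp, len, hi, hi'] using h i

theorem exists_between {F G : GridFace d n} (h : F ≤ G) {j : Fin d} (hj : j ∈ G.dirs)
    (hF : j ∉ F.dirs) : ∃ H : GridFace d n, F ≤ H ∧ H ≤ G ∧ j ∈ H.dirs ∧ H.dim = F.dim + 1 := by
  have hS : insert j F.dirs ⊆ G.dirs := Finset.insert_subset hj (dirs_subset h)
  refine ⟨interp F G _ hS, le_interp h hS (Finset.subset_insert _ _),
    interp_le h hS (Finset.subset_insert _ _), Finset.mem_insert_self _ _, ?_⟩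
  exact Finset.card_insert_of_notMem hF

/-- The facet of `F` on which the coordinate `j` is that of the grid point `k`. -/
def facet (F : GridFace d n) (j : Fin d) (k : Fin n) : GridFace d n where
  base := Function.update F.base j k
  dirs := F.dirs.erase j
  bound i hi := by
    rw [Function.update_of_ne (Finset.ne_of_mem_erase hi)]
    exact F.bound i (Finset.mem_of_mem_erase hi)

theorem facet_base_self (F : GridFace d n) (j : Fin d) (k : Fin n) : (F.facet j k).base j = k :=
  Function.update_self ..

theorem facet_base_of_ne (F : GridFace d n) {i j : Fin d} (h : i ≠ j) (k : Fin n) :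
    (F.facet j k).base i = F.base i := Function.update_of_ne h ..

theorem facet_len_of_ne (F : GridFace d n) {i j : Fin d} (h : i ≠ j) (k : Fin n) :
    (F.facet j k).len i = F.len i := by simp [len, facet, h]

theorem facet_len_self (F : GridFace d n) (j : Fin d) (k : Fin n) :
    (F.facet j k).len j = 0 := by simp [len, facet]

theorem facet_le {F : GridFace d n} {j : Fin d} {k : Fin n} (h : (F.base j : ℕ) ≤ k)
    (h' : (k : ℕ) ≤ F.base j + F.len j) : F.facet j k ≤ F := by
  intro i
  by_cases hi : i = j
  · subst hi
    rw [facet_base_self, facet_len_self]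
    exact ⟨h, h'⟩
  · rw [facet_base_of_ne _ hi, facet_len_of_ne _ hi]
    exact ⟨le_rfl, le_rfl⟩

theorem le_facet {F G : GridFace d n} (hG : G ≤ F) {j : Fin d} {k : Fin n}
    (h : G.base j = k) (h' : j ∉ G.dirs) : G ≤ F.facet j k := by
  intro i
  by_cases hi : i = j
  · subst hi
    rw [facet_base_self, facet_len_self, h, len_of_notMem h']
    exact ⟨le_rfl, le_rfl⟩
  · rw [facet_base_of_ne _ hi, facet_len_of_ne _ hi]
    exact hG i

theorem facet_dim {F : GridFace d n} {j : Fin d} (hj : j ∈ F.dirs) (k : Fin n) :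
    (F.facet j k).dim + 1 = F.dim := Finset.card_erase_add_one hj

theorem mem_facet {F : GridFace d n} {x : E d} (hx : x ∈ F.toSet) {j : Fin d} {k : Fin n}
    (h : x j = (k : ℕ) * eps n) : x ∈ (F.facet j k).toSet := by
  rw [mem_toSet] at hx ⊢
  intro i
  by_cases hi : i = j
  · subst hi
    rw [lo_apply, hi_apply, facet_base_self, facet_len_self, h]
    simp
  · rw [lo_apply, hi_apply, facet_base_of_ne _ hi, facet_len_of_ne _ hi, ← hi_apply]
    exact hx i

theorem dirs_eq_univ {F : GridFace d n} (h : F.dim = d) : F.dirs = Finset.univ := by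
  rw [← Finset.card_eq_iff_eq_univ, Fintype.card_fin]
  exact h

theorem exists_cube_ge (hn : 2 ≤ n) (F : GridFace d n) : ∃ C : GridFace d n, C.dim = d ∧ F ≤ C := by
  -- Outside the directions of `F` the cube extends upwards, except on the last grid hyperplane,
  -- where the cap `n - 2` makes it extend downwards.
  refine ⟨⟨fun i => if i ∈ F.dirs then F.base i else
    ⟨min (F.base i) (n - 2), by omega⟩, Finset.univ, fun i _ => ?_⟩, ?_, fun i => ?_⟩
  · split_ifs with h
    · exact F.bound i h
    · simp only
      omega
  · exact Finset.card_fin d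
  · by_cases h : i ∈ F.dirs
    · simp [len, h]
    · have := (F.base i).2
      simp [len, h]
      omega

/-- The grid point with given indices, as a face. -/
def vert (p : Fin d → Fin n) : GridFace d n := ⟨p, ∅, by simp⟩

@[simp] theorem vert_base (p : Fin d → Fin n) : (vert p).base = p := rfl

@[simp] theorem vert_dirs (p : Fin d → Fin n) : (vert p).dirs = ∅ := rfl

@[simp] theorem vert_len (p : Fin d → Fin n) (i : Fin d) : (vert p).len i = 0 := by simp [len]

theorem vert_base_le (F : GridFace d n) : vert F.base ≤ F := by
  intro i; simp

theorem vert_le_iff {F : GridFace d n} {p : Fin d → Fin n} :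
    vert p ≤ F ↔ ∀ i, (F.base i : ℕ) ≤ p i ∧ (p i : ℕ) ≤ F.base i + F.len i := by
  simp [le_def]

theorem mem_vertices {F : GridFace d n} {v : E d} :
    v ∈ F.vertices ↔ ∃ p, vert p ≤ F ∧ v = (vert p).lo := by
  constructor
  · intro h
    have key : ∀ i, ∃ k : Fin n, (F.base i : ℕ) ≤ k ∧ (k : ℕ) ≤ F.base i + F.len i ∧
        v i = ((k : ℕ) : ℝ) * eps n := by
      intro i
      rcases h i with h | h
      · exact ⟨F.base i, le_rfl, Nat.le_add_right _ _, h⟩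
      · refine ⟨⟨_, F.base_add_len_lt i⟩, Nat.le_add_right _ _, le_rfl, ?_⟩
        rw [h, hi_apply]
        push_cast
        rfl
    choose p hp using key
    exact ⟨p, vert_le_iff.2 fun i => ⟨(hp i).1, (hp i).2.1⟩, funext fun i => (hp i).2.2⟩
  · rintro ⟨p, hp, rfl⟩ i
    have h := vert_le_iff.1 hp i
    have h' := F.len_le_one i
    rw [lo_apply, lo_apply, hi_apply, vert_base]
    rcases h.1.eq_or_lt with h1 | h1
    · exact Or.inl (by rw [h1])
    · right
      have h2 : (p i : ℕ) = F.base i + F.len i := by omega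
      rw [h2]
      push_cast
      rfl

theorem toSet_eq_convexHull (hn : 2 ≤ n) (F : GridFace d n) :
    F.toSet = convexHull ℝ F.vertices := by
  have h : F.vertices = Set.pi univ fun i => {F.lo i, F.hi i} := by
    ext v; simp [vertices]
  rw [h, convexHull_pi]
  ext x
  simp only [mem_toSet, Set.mem_univ_pi, convexHull_pair]
  refine forall_congr' fun i => ?_
  rw [segment_eq_Icc (F.lo_le_hi hn i), Set.mem_Icc]

theorem combo_mem_relint {F : GridFace d n} {c x : E d} (hc : c ∈ F.relint) (hx : x ∈ F.toSet)
    {a b : ℝ} (ha : 0 < a) (hb : 0 ≤ b) (hab : a + b = 1) : a • c + b • x ∈ F.relint := by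
  rw [mem_toSet] at hx
  intro i
  simp only [Pi.add_apply, Pi.smul_apply, smul_eq_mul]
  have hb' : b = 1 - a := by linarith
  refine ⟨fun hi => ?_, fun hi => ?_⟩
  · obtain ⟨h1, h2⟩ := (hc i).1 hi
    obtain ⟨h3, h4⟩ := hx i
    have h5 := mul_lt_mul_of_pos_left h1 ha
    have h6 := mul_lt_mul_of_pos_left h2 ha
    have h7 := mul_le_mul_of_nonneg_left h3 hb
    have h8 := mul_le_mul_of_nonneg_left h4 hb
    have h9 : a * F.lo i + b * F.lo i = F.lo i := by rw [← add_mul, hab, one_mul]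
    have h10 : a * F.hi i + b * F.hi i = F.hi i := by rw [← add_mul, hab, one_mul]
    constructor <;> linarith
  · have h := hx i
    rw [hi_of_notMem hi] at h
    rw [(hc i).2 hi, le_antisymm h.2 h.1, ← add_mul, hab, one_mul]

/-- The point `y` is where the ray from `c` through `x` leaves `F`. -/
theorem exists_mem_facet_segment (hn : 2 ≤ n) {F : GridFace d n} {c x : E d} (hc : c ∈ F.relint)
    (hx : x ∈ F.toSet) (hd : 0 < F.dim) :
    ∃ G ≤ F, G.dim + 1 = F.dim ∧ ∃ y ∈ G.toSet, x ∈ segment ℝ c y := by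
  have hlo : ∀ j, (F.facet j (F.base j)) ≤ F := fun j => facet_le le_rfl (Nat.le_add_right _ _)
  have hhi : ∀ j, (F.facet j ⟨_, F.base_add_len_lt j⟩) ≤ F :=
    fun j => facet_le (Nat.le_add_right _ _) le_rfl
  have hxF := hx
  rw [mem_toSet] at hx
  -- The maximum of `g` over the directions of `F` is the gauge of `F` about `c` evaluated at `x`. A
  -- maximising direction `j` is one whose facet is hit by the ray, and scaling `x - c` by the
  -- inverse of `g j` gives the exit point.
  let g : Fin d → ℝ := fun i => max ((x i - c i) / (F.hi i - c i)) ((c i - x i) / (c i - F.lo i))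
  obtain ⟨j, hj, hmax⟩ := F.dirs.exists_max_image g (Finset.card_pos.1 hd)
  have hle : ∀ i ∈ F.dirs, x i - c i ≤ g j * (F.hi i - c i) ∧ c i - x i ≤ g j * (c i - F.lo i) := by
    intro i hi
    obtain ⟨h1, h2⟩ := (hc i).1 hi
    have h := max_le_iff.1 (hmax i hi)
    rw [div_le_iff₀ (by linarith), div_le_iff₀ (by linarith)] at h
    exact h
  have hge : x j - c j = g j * (F.hi j - c j) ∨ c j - x j = g j * (c j - F.lo j) := by
    obtain ⟨h1, h2⟩ := (hc j).1 hj
    rcases max_choice ((x j - c j) / (F.hi j - c j)) ((c j - x j) / (c j - F.lo j)) with h | h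
    · left
      rw [← div_eq_iff (by linarith)]; exact h.symm
    · right
      rw [← div_eq_iff (by linarith)]; exact h.symm
  have hout : ∀ i ∉ F.dirs, x i = c i := by
    intro i hi
    have h := hx i
    rw [hi_of_notMem hi] at h
    rw [(hc i).2 hi, le_antisymm h.2 h.1]
  obtain ⟨hcl, hch⟩ := (hc j).1 hj
  have hg1 : g j ≤ 1 := by
    refine max_le ((div_le_one (by linarith)).2 ?_) ((div_le_one (by linarith)).2 ?_)
    · linarith [(hx j).2]
    · linarith [(hx j).1]
  have hg0 : 0 ≤ g j := by
    rcases le_total (x j) (c j) with h | h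
    · exact le_max_of_le_right (div_nonneg (by linarith) (by linarith))
    · exact le_max_of_le_left (div_nonneg (by linarith) (by linarith))
  -- Gauge zero means `x = c`: there is no ray, and any point of any facet will do.
  rcases hg0.eq_or_lt with h0 | h0
  · refine ⟨_, hlo j, facet_dim hj _, _, lo_mem hn _, ?_⟩
    have hxc : x = c := by
      funext i
      by_cases hi : i ∈ F.dirs
      · have h := hle i hi
        rw [← h0, zero_mul, zero_mul] at h
        linarith
      · exact hout i hi
    rw [hxc]
    exact left_mem_segment ℝ _ _
  · let y : E d := c + (g j)⁻¹ • (x - c)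
    have hy : ∀ i, y i - c i = (x i - c i) / g j := by
      intro i
      simp only [y, Pi.add_apply, Pi.smul_apply, Pi.sub_apply, smul_eq_mul]
      rw [div_eq_inv_mul]; ring
    have hyF : y ∈ F.toSet := by
      rw [mem_toSet]
      intro i
      have h := hy i
      by_cases hi : i ∈ F.dirs
      · obtain ⟨h1, h2⟩ := hle i hi
        rw [← div_le_iff₀' h0] at h1 h2
        have h3 : (c i - x i) / g j = -((x i - c i) / g j) := by rw [← neg_div, neg_sub]
        constructor <;> linarith
      · rw [hout i hi, sub_self, zero_div] at h
        rw [hi_of_notMem hi, sub_eq_zero.1 h, (hc i).2 hi]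
        exact ⟨le_rfl, le_rfl⟩
    have hseg : x ∈ segment ℝ c y := by
      refine ⟨1 - g j, g j, by linarith, hg0, by ring, ?_⟩
      funext i
      have h := hy i
      rw [eq_div_iff h0.ne'] at h
      simp only [Pi.add_apply, Pi.smul_apply, smul_eq_mul]
      linarith
    have hyj := hy j
    rcases hge with h | h
    · refine ⟨_, hhi j, facet_dim hj _, y, mem_facet hyF ?_, hseg⟩
      rw [h, mul_div_cancel_left₀ _ h0.ne'] at hyj
      have : y j = F.hi j := by linarith
      rw [this, hi_apply]
      push_cast
      rfl
    · refine ⟨_, hlo j, facet_dim hj _, y, mem_facet hyF ?_, hseg⟩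
      rw [← neg_sub (c j) (x j), h, neg_div, mul_div_cancel_left₀ _ h0.ne'] at hyj
      have : y j = F.lo j := by linarith
      rw [this, lo_apply]

/-! ### Chains of faces -/

/-- `F h ≤ ⋯ ≤ F m` is a chain of faces with `dim (F i) = i`. -/
def IsChain (h m : ℕ) (F : ℕ → GridFace d n) : Prop :=
  (∀ i, h ≤ i → i ≤ m → (F i).dim = i) ∧ ∀ i, h ≤ i → i < m → F i ≤ F (i + 1)

namespace IsChain

variable {h m : ℕ} {F : ℕ → GridFace d n}

theorem mono (H : IsChain h m F) {h' m' : ℕ} (hh : h ≤ h') (hm : m' ≤ m) : IsChain h' m' F :=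
  ⟨fun i hi hi' => H.1 i (hh.trans hi) (hi'.trans hm),
    fun i hi hi' => H.2 i (hh.trans hi) (hi'.trans_le hm)⟩

theorem le (H : IsChain h m F) {i j : ℕ} (hi : h ≤ i) (hij : i ≤ j) (hj : j ≤ m) : F i ≤ F j := by
  induction j, hij using Nat.le_induction with
  | base => exact le_rfl
  | succ k hk ih => exact (ih (by omega)).trans (H.2 k (by omega) (by omega))

theorem snoc (H : IsChain h m F) (hm : h ≤ m) {G : GridFace d n} (hG : F m ≤ G)
    (hd : G.dim = m + 1) : IsChain h (m + 1) (Function.update F (m + 1) G) := by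
  refine ⟨fun i hi hi' => ?_, fun i hi hi' => ?_⟩
  · rcases hi'.eq_or_lt with rfl | hlt
    · simpa using hd
    · rw [Function.update_of_ne hlt.ne]
      exact H.1 i hi (by omega)
  · rw [Function.update_of_ne hi'.ne]
    rcases (Nat.lt_succ_iff.1 hi').eq_or_lt with rfl | hlt
    · simpa using hG
    · rw [Function.update_of_ne (by omega)]
      exact H.2 i hi hlt

/-- Directions of `G` missing from the last face are added one at a time. -/
theorem exists_extend (H : IsChain h m F) (hm : h ≤ m) {G : GridFace d n} (hG : F m ≤ G) :
    ∃ F', IsChain h G.dim F' ∧ F' G.dim = G ∧ ∀ i ≤ m, F' i = F i := by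
  have hle : m ≤ G.dim := by
    have := dim_le hG
    rwa [H.1 m hm le_rfl] at this
  obtain ⟨k, hk⟩ := Nat.exists_eq_add_of_le hle
  induction k generalizing m F with
  | zero =>
    have h1 : F m = G := eq_of_le_of_dim_le hG (by rw [H.1 m hm le_rfl, hk]; omega)
    rw [hk]
    exact ⟨F, H, h1, fun _ _ => rfl⟩
  | succ k ih =>
    have hne : ¬ G.dirs ⊆ (F m).dirs := by
      intro hs
      have h1 := Finset.card_le_card hs
      have h2 : (F m).dirs.card = m := H.1 m hm le_rfl
      have h3 : G.dirs.card = m + (k + 1) := hk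
      omega
    obtain ⟨j, hj, hj'⟩ := Finset.not_subset.1 hne
    obtain ⟨G', h1, h2, -, h4⟩ := exists_between hG hj hj'
    rw [H.1 m hm le_rfl] at h4
    obtain ⟨F', hF, hF', hF''⟩ := ih (H.snoc hm h1 h4) (by omega) (by simpa using h2)
      (by omega) (by omega)
    refine ⟨F', hF, hF', fun i hi => ?_⟩
    rw [hF'' i (by omega), Function.update_of_ne (by omega)]

end IsChain

theorem isChain_const (F : GridFace d n) : IsChain F.dim F.dim fun _ => F :=
  ⟨fun _ h h' => le_antisymm h h', fun _ h h' => absurd (h.trans_lt h') (lt_irrefl _)⟩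

end GridFace

open GridFace

/-! ### Iterated projection from the centres -/

/-- `Retracts N c x y` states that projecting `x` repeatedly from the centres `c F` of the faces
`F` with `N F` leads to `y`, a centre or a point of a face without centre. -/
inductive Retracts {d n : ℕ} (N : GridFace d n → Prop) (c : GridFace d n → E d) :
    E d → E d → Prop
  | terminal {x : E d} {F : GridFace d n} : ¬ N F → x ∈ F.toSet → Retracts N c x x
  | centre {F : GridFace d n} : N F → Retracts N c (c F) (c F)
  | step {F G : GridFace d n} {x y : E d} {a b : ℝ} : N F → G < F → x ∈ G.toSet →
      Retracts N c x y → 0 < a → 0 < b → a + b = 1 → Retracts N c (a • c F + b • x) y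

section

variable {d n : ℕ} {N : GridFace d n → Prop} {c : GridFace d n → E d}

/-- A point `a • c F + b • x` with `a > 0` is in the relative interior of `F`, which determines `F`.
As `x` is on a proper face, it is not in that interior, and this determines `a`, hence `b` and `x`.
So at most one projection step applies at any point, and none applies at a centre or in a face
without centre. -/
theorem Retracts.unique (hn : 2 ≤ n) (hc : ∀ F, N F → c F ∈ F.relint)
    (hN : ∀ F G, F ≤ G → N F → N G) {x y z : E d} (hy : Retracts N c x y)
    (hz : Retracts N c x z) : y = z := by
  have aux : ∀ {F G : GridFace d n} {x y : E d} {a b : ℝ}, N F → G < F → x ∈ G.toSet →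
      0 < a → 0 < b → a + b = 1 → Retracts N c (a • c F + b • x) y →
      ∃ (G' : GridFace d n) (x' : E d) (a' b' : ℝ), G' < F ∧ x' ∈ G'.toSet ∧ 0 < a' ∧ 0 < b' ∧
        a' + b' = 1 ∧ Retracts N c x' y ∧ a • c F + b • x = a' • c F + b' • x' := by
    intro F G x y a b hF hG hx ha hb hab h
    have hr : a • c F + b • x ∈ F.relint :=
      combo_mem_relint (hc F hF) ((toSet_subset_iff hn).2 hG.le hx) ha hb.le hab
    generalize hw : a • c F + b • x = w at h hr
    cases h with
    | terminal h1 h2 => exact absurd (hN _ _ (le_of_mem_relint hn hr h2) hF) h1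
    | @centre F' h1 =>
      have hFF := eq_of_mem_relint hn hr (hc _ h1)
      subst hFF
      have h2 : b • x = b • c F := by
        rw [← sub_eq_zero, ← smul_sub]
        have h3 : b = 1 - a := by linarith
        have h4 : a • c F + b • x - c F = 0 := by rw [hw, sub_self]
        rw [← h4, h3]
        module
      have h3 : x = c F := smul_right_injective _ hb.ne' h2
      rw [h3] at hx
      exact absurd (le_of_mem_relint hn (hc F hF) hx) hG.not_ge
    | @step F' G' x' _ a' b' h1 h2 h3 h4 h5 h6 h7 =>
      have hFF := eq_of_mem_relint hn hr
        (combo_mem_relint (hc _ h1) ((toSet_subset_iff hn).2 h2.le h3) h5 h6.le h7)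
      subst hFF
      exact ⟨G', x', a', b', h2, h3, h5, h6, h7, h4, rfl⟩
  have term : ∀ {F : GridFace d n} {x z : E d}, ¬ N F → x ∈ F.toSet → Retracts N c x z →
      x = z := by
    intro F x z hF hx h
    cases h with
    | terminal => rfl
    | centre => rfl
    | step h1 h2 h3 h4 h5 h6 h7 =>
      exact absurd (hN _ _ (le_of_mem_relint hn (combo_mem_relint (hc _ h1)
        ((toSet_subset_iff hn).2 h2.le h3) h5 h6.le h7) hx) h1) hF
  have lt_aux : ∀ {F G G' : GridFace d n} {x x' : E d} {a b a' b' : ℝ}, N F → G < F →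
      x ∈ G.toSet → G' < F → x' ∈ G'.toSet → 0 < b → a + b = 1 → 0 < b' → a' + b' = 1 →
      a • c F + b • x = a' • c F + b' • x' → a' ≤ a := by
    intro F G G' x x' a b a' b' hF hG hx hG' hx' hb hab hb' hab' h
    by_contra! hlt
    -- With a smaller weight on the centre, `x` would still be a combination with positive weight on
    -- `c F`, hence in the relative interior of `F`, although it lies on a proper face.
    have hx2 : x = ((a' - a) / b) • c F + (b' / b) • x' := by
      have h1 : b • x = (a' - a) • c F + b' • x' := by
        rw [sub_smul, sub_add_eq_add_sub, ← h]; abel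
      rw [div_eq_inv_mul, div_eq_inv_mul, mul_smul, mul_smul, ← smul_add, ← h1,
        inv_smul_smul₀ hb.ne']
    have hr : x ∈ F.relint := by
      rw [hx2]
      refine combo_mem_relint (hc F hF) ((toSet_subset_iff hn).2 hG'.le hx')
        (div_pos (by linarith) hb) (by positivity) ?_
      rw [← add_div, div_eq_one_iff_eq hb.ne']
      linarith
    exact absurd (le_of_mem_relint hn hr hx) hG.not_ge
  induction hy generalizing z with
  | terminal h1 h2 => exact term h1 h2 hz
  | @centre F hF =>
    generalize hw : c F = w at hz
    have hr : w ∈ F.relint := hw ▸ hc F hF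
    cases hz with
    | terminal => rfl
    | centre => rfl
    | @step F' G' x' _ a' b' h1 h2 h3 h4 h5 h6 h7 =>
      have hFF := eq_of_mem_relint hn hr
        (combo_mem_relint (hc _ h1) ((toSet_subset_iff hn).2 h2.le h3) h5 h6.le h7)
      subst hFF
      have h8 : b' • x' = b' • c F := by
        have h9 : b' = 1 - a' := by linarith
        rw [← sub_eq_zero, ← smul_sub]
        have h10 : a' • c F + b' • x' - c F = 0 := sub_eq_zero.2 hw.symm
        rw [← h10, h9]
        module
      have h9 : x' = c F := smul_right_injective _ h6.ne' h8
      rw [h9] at h3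
      exact absurd (le_of_mem_relint hn (hc F hF) h3) h2.not_ge
  | @step F G x y a b h1 h2 h3 h4 h5 h6 h7 ih =>
    obtain ⟨G', x', a', b', hG', hx', ha', hb', hab', hr, he⟩ := aux h1 h2 h3 h5 h6 h7 hz
    have haa : a = a' := le_antisymm (lt_aux h1 hG' hx' h2 h3 hb' hab' h6 h7 he.symm)
      (lt_aux h1 h2 h3 hG' hx' h6 h7 hb' hab' he)
    subst haa
    have hbb : b = b' := by linarith
    subst hbb
    have hxx : x = x' := smul_right_injective _ h6.ne' (add_left_cancel he)
    subst hxx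
    exact ih hr

/-- The convex hull of the centres of the faces of a chain. -/
abbrev centreHull (c : GridFace d n → E d) (F : ℕ → GridFace d n) (l m : ℕ) : Set (E d) :=
  convexHull ℝ ((fun i => c (F i)) '' Set.Icc l m)

theorem centreHull_mono (c : GridFace d n → E d) (F : ℕ → GridFace d n) {l m l' m' : ℕ}
    (hl : l' ≤ l) (hm : m ≤ m') : centreHull c F l m ⊆ centreHull c F l' m' :=
  convexHull_mono (Set.image_mono (Set.Icc_subset_Icc hl hm))

theorem centreHull_congr (c : GridFace d n → E d) {F G : ℕ → GridFace d n} {l m : ℕ}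
    (h : ∀ i ∈ Set.Icc l m, F i = G i) : centreHull c F l m = centreHull c G l m := by
  unfold centreHull
  rw [Set.image_congr fun i hi => by rw [h i hi]]

theorem mem_centreHull_succ {F : ℕ → GridFace d n} {l m : ℕ} (hl : l ≤ m) {x : E d}
    (hx : x ∈ centreHull c F l (m + 1)) :
    ∃ y ∈ centreHull c F l m, ∃ a b : ℝ, 0 ≤ a ∧ 0 ≤ b ∧ a + b = 1 ∧
      x = a • c (F (m + 1)) + b • y := by
  have h : Set.Icc l (m + 1) = insert (m + 1) (Set.Icc l m) := by
    ext i; simp only [Set.mem_Icc, Set.mem_insert_iff]; omega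
  unfold centreHull at hx
  rw [h, Set.image_insert_eq, convexHull_insert ((Set.nonempty_Icc.2 hl).image _)] at hx
  simp only [convexJoin_singleton_left, Set.mem_iUnion] at hx
  obtain ⟨y, hy, a, b, ha, hb, hab, rfl⟩ := hx
  exact ⟨y, hy, a, b, ha, hb, hab, rfl⟩

theorem centreHull_self (F : ℕ → GridFace d n) (m : ℕ) : centreHull c F m m = {c (F m)} := by
  unfold centreHull
  rw [Set.Icc_self, Set.image_singleton, convexHull_singleton]

theorem centreHull_of_lt (F : ℕ → GridFace d n) {l m : ℕ} (h : m < l) :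
    centreHull c F l m = ∅ := by
  unfold centreHull
  rw [Set.Icc_eq_empty (by omega), Set.image_empty, convexHull_empty]

theorem centreHull_subset (hn : 2 ≤ n) (hc : ∀ F, N F → c F ∈ F.relint) {F : ℕ → GridFace d n}
    {l m : ℕ} (H : IsChain l m F) (hF : ∀ i ∈ Set.Icc l m, N (F i)) :
    centreHull c F l m ⊆ (F m).toSet := by
  refine convexHull_min ?_ (F m).convex_toSet
  rintro _ ⟨i, hi, rfl⟩
  exact (toSet_subset_iff hn).2 (H.le hi.1 hi.2 le_rfl) (relint_subset hn _ (hc _ (hF i hi)))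

/-- The index `k` is the last one whose centre has positive weight: that centre pulls the point into
the relative interior of its face. -/
theorem exists_mem_relint_of_mem_centreHull (hn : 2 ≤ n) (hc : ∀ F, N F → c F ∈ F.relint)
    {F : ℕ → GridFace d n} {l m : ℕ} (H : IsChain l m F) (hF : ∀ i ∈ Set.Icc l m, N (F i))
    {x : E d} (hx : x ∈ centreHull c F l m) :
    ∃ k ∈ Set.Icc l m, x ∈ (F k).relint ∧ x ∈ centreHull c F l k := by
  induction m generalizing x with
  | zero =>
    rcases Nat.eq_zero_or_pos l with rfl | hl
    · refine ⟨0, by simp, ?_, hx⟩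
      rw [centreHull_self] at hx
      rw [hx]
      exact hc _ (hF 0 (by simp))
    · rw [centreHull_of_lt F hl] at hx
      exact hx.elim
  | succ m ih =>
    rcases lt_trichotomy l (m + 1) with hl | rfl | hl
    · obtain ⟨y, hy, a, b, ha, hb, hab, rfl⟩ := mem_centreHull_succ (by omega) hx
      have hF' : ∀ i ∈ Set.Icc l m, N (F i) := fun i hi => hF i ⟨hi.1, by have := hi.2; omega⟩
      rcases ha.eq_or_lt with rfl | ha
      · have hb1 : b = 1 := by linarith
        subst hb1
        rw [zero_smul, one_smul, zero_add] at hx ⊢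
        obtain ⟨k, hk, h⟩ := ih (H.mono le_rfl (Nat.le_succ m)) hF' hy
        exact ⟨k, ⟨hk.1, by have := hk.2; omega⟩, h⟩
      · refine ⟨m + 1, ⟨hl.le, le_rfl⟩, combo_mem_relint (hc _ (hF _ ⟨hl.le, le_rfl⟩)) ?_ ha hb hab,
          hx⟩
        exact (toSet_subset_iff hn).2 (H.2 m (by omega) (by omega))
          (centreHull_subset hn hc (H.mono le_rfl (Nat.le_succ m)) hF' hy)
    · refine ⟨m + 1, by simp, ?_, hx⟩
      rw [centreHull_self] at hx
      rw [hx]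
      exact hc _ (hF _ (by simp))
    · rw [centreHull_of_lt F hl] at hx
      exact hx.elim

theorem GridFace.IsChain.lt_succ {F : ℕ → GridFace d n} {l m : ℕ}
    (H : GridFace.IsChain l m F) {i : ℕ} (hi : l ≤ i) (hi' : i < m) : F i < F (i + 1) := by
  refine lt_of_le_of_ne (H.2 i hi hi') fun h => ?_
  have h1 := H.1 i hi hi'.le
  have h2 := H.1 (i + 1) (by omega) hi'
  rw [h, h2] at h1
  omega

/-- Each projection removes the centre of largest index with positive weight; the last remaining one
is the end point. -/
theorem Retracts.of_mem_centreHull (hn : 2 ≤ n) (hc : ∀ F, N F → c F ∈ F.relint)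
    {F : ℕ → GridFace d n} {l m : ℕ} (H : GridFace.IsChain l m F)
    (hF : ∀ i ∈ Set.Icc l m, N (F i))
    {x : E d} (hx : x ∈ centreHull c F l m) : ∃ G, N G ∧ Retracts N c x (c G) := by
  induction m generalizing x with
  | zero =>
    rcases Nat.eq_zero_or_pos l with rfl | hl
    · rw [centreHull_self] at hx
      rw [hx]
      exact ⟨_, hF 0 (by simp), .centre (hF 0 (by simp))⟩
    · rw [centreHull_of_lt F hl] at hx
      exact hx.elim
  | succ m ih =>
    rcases lt_trichotomy l (m + 1) with hl | rfl | hl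
    · obtain ⟨y, hy, a, b, ha, hb, hab, rfl⟩ := mem_centreHull_succ (by omega) hx
      have hF' : ∀ i ∈ Set.Icc l m, N (F i) := fun i hi => hF i ⟨hi.1, by have := hi.2; omega⟩
      have H' := H.mono le_rfl (Nat.le_succ m)
      have hm := hF (m + 1) ⟨hl.le, le_rfl⟩
      obtain ⟨G, hG, h⟩ := ih H' hF' hy
      rcases ha.eq_or_lt with rfl | ha
      · have hb1 : b = 1 := by linarith
        subst hb1
        rw [zero_smul, one_smul, zero_add]
        exact ⟨G, hG, h⟩
      rcases hb.eq_or_lt with rfl | hb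
      · have ha1 : a = 1 := by linarith
        subst ha1
        rw [zero_smul, one_smul, add_zero]
        exact ⟨_, hm, .centre hm⟩
      · exact ⟨G, hG, .step hm (IsChain.lt_succ H (by omega) (by omega))
          (centreHull_subset hn hc H' hF' hy) h ha hb hab⟩
    · rw [centreHull_self] at hx
      rw [hx]
      exact ⟨_, hF _ (by simp), .centre (hF _ (by simp))⟩
    · rw [centreHull_of_lt F hl] at hx
      exact hx.elim

/-- The projections remove the centres from the top down and leave the component `y`, whose positive
weight keeps the process from stopping at a centre. -/
theorem Retracts.of_mem_join (hn : 2 ≤ n) (hc : ∀ F, N F → c F ∈ F.relint)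
    {F : ℕ → GridFace d n} {h m : ℕ} (H : GridFace.IsChain h m F)
    (hF : ∀ i ∈ Set.Icc (h + 1) m, N (F i)) {y : E d} (hy : y ∈ (F h).toSet) (hh : ¬ N (F h))
    {r : E d} (hr : r ∈ centreHull c F (h + 1) m) {s t : ℝ} (hs : 0 < s) (ht : 0 ≤ t)
    (hst : t + s = 1) : Retracts N c (t • r + s • y) y := by
  induction m generalizing r s t with
  | zero =>
    rw [centreHull_of_lt F (Nat.succ_pos h)] at hr
    exact hr.elim
  | succ m ih =>
    rcases ht.eq_or_lt with rfl | ht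
    · have hs1 : s = 1 := by linarith
      subst hs1
      rw [zero_smul, one_smul, zero_add]
      exact .terminal hh hy
    rcases lt_trichotomy (h + 1) (m + 1) with hl | hl | hl
    · obtain ⟨r', hr', a, b, ha, hb, hab, rfl⟩ := mem_centreHull_succ (by omega) hr
      have H' := H.mono le_rfl (Nat.le_succ m)
      have hF' : ∀ i ∈ Set.Icc (h + 1) m, N (F i) :=
        fun i hi => hF i ⟨hi.1, by have := hi.2; omega⟩
      rcases ha.eq_or_lt with rfl | ha
      · have hb1 : b = 1 := by linarith
        subst hb1
        rw [zero_smul, one_smul, zero_add]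
        exact ih H' hF' hr' hs ht.le hst
      have hta : 0 < t * a := mul_pos ht ha
      have hβ : 0 < t * b + s := by positivity
      -- The top centre is separated with weight `t * a`; the rest is renormalised to a point of the
      -- join over the shorter chain.
      have e : t • (a • c (F (m + 1)) + b • r') + s • y = (t * a) • c (F (m + 1)) +
          (t * b + s) • ((t * b / (t * b + s)) • r' + (s / (t * b + s)) • y) := by
        rw [smul_add (t * b + s), smul_smul (t * b + s), smul_smul (t * b + s),
          mul_div_cancel₀ _ hβ.ne', mul_div_cancel₀ _ hβ.ne']
        module
      rw [e]
      have hsum : t * b / (t * b + s) + s / (t * b + s) = 1 := by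
        rw [← add_div, div_self hβ.ne']
      have h1 : 0 ≤ t * b / (t * b + s) := by positivity
      have h2 : 0 < s / (t * b + s) := by positivity
      refine .step (hF _ ⟨hl.le, le_rfl⟩) (IsChain.lt_succ H (by omega) (by omega)) ?_
        (ih H' hF' hr' h2 h1 hsum) hta hβ ?_
      · refine (F m).convex_toSet (centreHull_subset hn hc (H'.mono (Nat.le_succ h) le_rfl) hF' hr')
          ((toSet_subset_iff hn).2 (H'.le le_rfl (by omega) le_rfl) hy) h1 h2.le hsum
      · rw [← add_assoc, ← mul_add, hab, mul_one, hst]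
    · have hl' : h = m := by omega
      subst hl'
      rw [centreHull_self] at hr
      rw [hr]
      exact .step (hF _ (by simp)) (IsChain.lt_succ H le_rfl (by omega)) hy (.terminal hh hy)
        ht hs hst
    · rw [centreHull_of_lt F hl] at hr
      exact hr.elim

/-- Project `x` from the centre of `F` to a facet and repeat until the face reached has no centre;
the faces met form the chain. This stops at the latest at a vertex, by `h0`. -/
theorem exists_mem_polytope (hn : 2 ≤ n) (hc : ∀ F, N F → c F ∈ F.relint)
    (h0 : ∀ F, F.dim = 0 → ¬ N F) (F : GridFace d n) (hF : N F) {x : E d} (hx : x ∈ F.toSet) :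
    ∃ h < F.dim, ∃ G : ℕ → GridFace d n, GridFace.IsChain h F.dim G ∧ G F.dim = F ∧ ¬ N (G h) ∧
      N (G (h + 1)) ∧ x ∈ convexHull ℝ ((G h).vertices ∪
        (fun i => c (G i)) '' Set.Icc (h + 1) F.dim) := by
  obtain ⟨m, hm⟩ : ∃ m, F.dim = m := ⟨_, rfl⟩
  induction m generalizing F x with
  | zero => exact absurd hF (h0 F hm)
  | succ m ih =>
    obtain ⟨F', hF', hd, x', hx', hseg⟩ := exists_mem_facet_segment hn (hc F hF) hx (by omega)
    have hd' : F'.dim = m := by omega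
    rw [hm]
    by_cases hN' : N F'
    · obtain ⟨h, hh, G, H, hG, h1, h2, h3⟩ := ih F' hN' hx' hd'
      rw [hd'] at hh H hG h3
      refine ⟨h, by omega, _, H.snoc hh.le (hG.le.trans hF') hm, by simp, ?_, ?_, ?_⟩
      · rwa [Function.update_of_ne (by omega)]
      · rwa [Function.update_of_ne (by omega)]
      · rw [Function.update_of_ne (by omega)]
        refine (convex_convexHull ℝ _).segment_subset (subset_convexHull ℝ _ ?_)
          (convexHull_mono (Set.union_subset_union_right _ ?_) h3) hseg
        · exact Or.inr ⟨m + 1, ⟨by omega, le_rfl⟩, by simp⟩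
        · rintro _ ⟨i, hi, rfl⟩
          have := hi.2
          exact ⟨i, ⟨hi.1, by omega⟩, by simp only [Function.update_of_ne (by omega : i ≠ m + 1)]⟩
    · have H := (isChain_const F').snoc le_rfl hF' (by omega)
      rw [hd'] at H
      refine ⟨m, by omega, _, H, by simp, ?_, by simpa using hF, ?_⟩
      · rwa [Function.update_of_ne (by omega)]
      · rw [Function.update_of_ne (by omega)]
        rw [toSet_eq_convexHull hn] at hx'
        refine (convex_convexHull ℝ _).segment_subset (subset_convexHull ℝ _ ?_)
          (convexHull_mono Set.subset_union_left hx') hseg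
        exact Or.inr ⟨m + 1, ⟨by omega, le_rfl⟩, by simp⟩

end

/-! ### Coordinates of a barycentre -/

section Barycentre

variable {d : ℕ} {B : Set (E d)} {i : Fin d} {r : ℝ}

theorem barycentre_apply (hB : B.Finite) (i : Fin d) :
    barycentre B i = (∑ x ∈ hB.toFinset, x i) / (hB.toFinset.card : ℝ) := by
  unfold barycentre
  rw [finsum_mem_eq_finite_toFinset_sum _ hB, Pi.smul_apply, Finset.sum_apply,
    Set.ncard_eq_toFinset_card B hB, smul_eq_mul, div_eq_inv_mul]

theorem barycentre_apply_lt (hB : B.Finite) (h : ∀ x ∈ B, x i ≤ r) (h' : ∃ x ∈ B, x i < r) :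
    barycentre B i < r := by
  obtain ⟨y, hy, hlt⟩ := h'
  have hpos : (0 : ℝ) < hB.toFinset.card := by
    exact_mod_cast Finset.card_pos.2 ⟨y, hB.mem_toFinset.2 hy⟩
  rw [barycentre_apply hB, div_lt_iff₀ hpos, mul_comm, ← nsmul_eq_mul, ← Finset.sum_const]
  exact Finset.sum_lt_sum (fun x hx => h x (hB.mem_toFinset.1 hx)) ⟨y, hB.mem_toFinset.2 hy, hlt⟩

theorem lt_barycentre_apply (hB : B.Finite) (h : ∀ x ∈ B, r ≤ x i) (h' : ∃ x ∈ B, r < x i) :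
    r < barycentre B i := by
  obtain ⟨y, hy, hlt⟩ := h'
  have hpos : (0 : ℝ) < hB.toFinset.card := by
    exact_mod_cast Finset.card_pos.2 ⟨y, hB.mem_toFinset.2 hy⟩
  rw [barycentre_apply hB, lt_div_iff₀ hpos, mul_comm, ← nsmul_eq_mul, ← Finset.sum_const]
  exact Finset.sum_lt_sum (fun x hx => h x (hB.mem_toFinset.1 hx)) ⟨y, hB.mem_toFinset.2 hy, hlt⟩

theorem barycentre_apply_eq (hB : B.Finite) (hne : B.Nonempty) (h : ∀ x ∈ B, x i = r) :
    barycentre B i = r := by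
  obtain ⟨y, hy⟩ := hne
  have hpos : (0 : ℝ) < hB.toFinset.card := by
    exact_mod_cast Finset.card_pos.2 ⟨y, hB.mem_toFinset.2 hy⟩
  rw [barycentre_apply hB, Finset.sum_congr rfl fun x hx => h x (hB.mem_toFinset.1 hx),
    Finset.sum_const, nsmul_eq_mul, mul_div_cancel_left₀ _ hpos.ne']

end Barycentre

/-! ### Mixed faces and their centres -/

variable {d n ne : ℕ} {𝓜 : E d → SignType} {b : E d → E d → E d}

/-- Grid points of both signs are vertices of `F`. -/
def IsMixed (𝓜 : E d → SignType) (F : GridFace d n) : Prop :=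
  ∃ p q, vert p ≤ F ∧ vert q ≤ F ∧ 𝓜 (vert p).lo = -1 ∧ 𝓜 (vert q).lo = 1

theorem sign_cases {a b : SignType} (ha : a ≠ 0) (hb : b ≠ 0) (h : a ≠ b) :
    (a = -1 ∧ b = 1) ∨ (b = -1 ∧ a = 1) := by
  revert a b
  decide

theorem IsMixed.mono {F G : GridFace d n} (h : F ≤ G) : IsMixed 𝓜 F → IsMixed 𝓜 G := by
  rintro ⟨p, q, hp, hq, h1, h2⟩
  exact ⟨p, q, hp.trans h, hq.trans h, h1, h2⟩

theorem isMixed_of_ne (h𝓜 : ∀ p : Fin d → Fin n, 𝓜 (vert p).lo ≠ 0) {F : GridFace d n}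
    {p q : Fin d → Fin n} (hp : vert p ≤ F) (hq : vert q ≤ F)
    (h : 𝓜 (vert p).lo ≠ 𝓜 (vert q).lo) : IsMixed 𝓜 F := by
  rcases sign_cases (h𝓜 p) (h𝓜 q) h with h | h
  · exact ⟨p, q, hp, hq, h⟩
  · exact ⟨q, p, hq, hp, h⟩

theorem not_isMixed_of_dim_eq_zero {F : GridFace d n} (h : F.dim = 0) : ¬ IsMixed 𝓜 F := by
  rintro ⟨p, q, hp, hq, h1, h2⟩
  have hp' := eq_of_le_of_dim_le hp (by omega)
  have hq' := eq_of_le_of_dim_le hq (by omega)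
  rw [hp'] at h1
  rw [hq', h1] at h2
  exact absurd h2 (by decide)

/-- If no edge in the direction `j` is mixed, moving a vertex of `F` along `j` preserves its label,
so both facets orthogonal to `j` show the two labels. -/
theorem IsMixed.edge_or_facets (h𝓜 : ∀ p : Fin d → Fin n, 𝓜 (vert p).lo ≠ 0)
    {F : GridFace d n} (hF : IsMixed 𝓜 F) {j : Fin d} (hj : j ∈ F.dirs) :
    (∃ e ≤ F, e.dim = 1 ∧ j ∈ e.dirs ∧ IsMixed 𝓜 e) ∨
      (IsMixed 𝓜 (F.facet j (F.base j)) ∧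
        IsMixed 𝓜 (F.facet j ⟨(F.base j : ℕ) + 1, F.bound j hj⟩)) := by
  rw [or_iff_not_imp_left]
  intro hno
  set k : Fin n := ⟨(F.base j : ℕ) + 1, F.bound j hj⟩ with hk
  have hup : ∀ p : Fin d → Fin n, ∀ l : Fin n, (l = F.base j ∨ l = k) → vert p ≤ F →
      vert (Function.update p j l) ≤ F ∧ 𝓜 (vert (Function.update p j l)).lo = 𝓜 (vert p).lo := by
    intro p l hl hp
    -- This `interp` is the edge of `F` through `p` in the direction `j`.
    have hle : vert p ≤ interp (vert p) F {j} (by simpa using hj) := le_interp hp _ (by simp)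
    have hle' : interp (vert p) F {j} (by simpa using hj) ≤ F := interp_le hp _ (by simp)
    have hu : vert (Function.update p j l) ≤ interp (vert p) F {j} (by simpa using hj) := by
      rw [vert_le_iff]
      intro i
      by_cases hi : i = j
      · subst hi
        rw [Function.update_self]
        rcases hl with rfl | rfl <;> simp [interp, len, hk]
      · simp [interp, len, hi]
    refine ⟨hu.trans hle', ?_⟩
    by_contra hne
    exact hno ⟨_, hle', Finset.card_singleton j, Finset.mem_singleton_self j,
      isMixed_of_ne h𝓜 hu hle hne⟩
  have hfacet : ∀ l : Fin n, (l = F.base j ∨ l = k) → IsMixed 𝓜 (F.facet j l) := by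
    intro l hl
    obtain ⟨p, q, hp, hq, h1, h2⟩ := hF
    exact ⟨_, _, le_facet (hup p l hl hp).1 (Function.update_self ..) (by simp),
      le_facet (hup q l hl hq).1 (Function.update_self ..) (by simp),
      (hup p l hl hp).2.trans h1, (hup q l hl hq).2.trans h2⟩
  exact ⟨hfacet _ (Or.inl rfl), hfacet _ (Or.inr rfl)⟩

theorem facet_base_le (F : GridFace d n) (j : Fin d) : F.facet j (F.base j) ≤ F :=
  facet_le le_rfl (Nat.le_add_right _ _)

theorem facet_succ_le {F : GridFace d n} {j : Fin d} (hj : j ∈ F.dirs) :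
    F.facet j ⟨(F.base j : ℕ) + 1, F.bound j hj⟩ ≤ F :=
  facet_le (Nat.le_add_right _ _) (by rw [len_of_mem hj])

theorem IsMixed.exists_edge (h𝓜 : ∀ p : Fin d → Fin n, 𝓜 (vert p).lo ≠ 0)
    {F : GridFace d n} (hF : IsMixed 𝓜 F) : ∃ e ≤ F, e.dim = 1 ∧ IsMixed 𝓜 e := by
  obtain ⟨m, hm⟩ : ∃ m, F.dim = m := ⟨_, rfl⟩
  induction m generalizing F with
  | zero => exact absurd hF (not_isMixed_of_dim_eq_zero hm)
  | succ m ih =>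
    obtain ⟨j, hj⟩ : F.dirs.Nonempty := Finset.card_pos.1 (by unfold GridFace.dim at hm; omega)
    rcases hF.edge_or_facets h𝓜 hj with ⟨e, h1, h2, -, h3⟩ | ⟨h, -⟩
    · exact ⟨e, h1, h2, h3⟩
    · obtain ⟨e, h1, h2, h3⟩ := ih h (by have := facet_dim hj (F.base j); omega)
      exact ⟨e, h1.trans (facet_base_le F j), h2, h3⟩

/-- The edges of a mixed square that are mixed are at least two. -/
theorem IsMixed.exists_ne_edge (h𝓜 : ∀ p : Fin d → Fin n, 𝓜 (vert p).lo ≠ 0)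
    {e F : GridFace d n} (he : e.dim = 1) (hF : F.dim = 2) (hm : IsMixed 𝓜 F) :
    ∃ e' ≤ F, e'.dim = 1 ∧ e' ≠ e ∧ IsMixed 𝓜 e' := by
  -- With `j` not a direction of `e`, a mixed edge along `j` differs from `e`; failing that, two
  -- opposite edges are mixed and at most one of them is `e`.
  obtain ⟨j, hj, hje⟩ : ∃ j ∈ F.dirs, j ∉ e.dirs := by
    refine Finset.not_subset.1 fun h => ?_
    have := Finset.card_le_card h
    unfold GridFace.dim at he hF
    omega
  rcases hm.edge_or_facets h𝓜 hj with ⟨e', h1, h2, h3, h4⟩ | ⟨h, h'⟩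
  · exact ⟨e', h1, h2, fun h => hje (h ▸ h3), h4⟩
  · by_cases hb : F.facet j (F.base j) = e
    · refine ⟨_, facet_succ_le hj, ?_, ?_, h'⟩
      · have := facet_dim hj ⟨(F.base j : ℕ) + 1, F.bound j hj⟩
        omega
      · intro h2
        have h3 := congrArg (fun G : GridFace d n => (G.base j : ℕ)) (hb.trans h2.symm)
        simp only [facet_base_self] at h3
        omega
    · refine ⟨_, facet_base_le F j, ?_, hb, h⟩
      have := facet_dim hj (F.base j)
      omega

theorem mem_boundaryPoints (hn : 2 ≤ n) {F : GridFace d n} {x : E d} :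
    x ∈ boundaryPoints 𝓜 b F ↔ ∃ e ≤ F, e.dim = 1 ∧ ∃ p q, vert p ≤ e ∧ vert q ≤ e ∧
      𝓜 (vert p).lo = -1 ∧ 𝓜 (vert q).lo = 1 ∧ x = b (vert p).lo (vert q).lo := by
  constructor
  · rintro ⟨e, he, hF, u, hu, v, hv, h1, h2, rfl⟩
    obtain ⟨p, hp, rfl⟩ := mem_vertices.1 hu
    obtain ⟨q, hq, rfl⟩ := mem_vertices.1 hv
    exact ⟨e, (toSet_subset_iff hn).1 hF, he, p, q, hp, hq, h1, h2, rfl⟩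
  · rintro ⟨e, hF, he, p, q, hp, hq, h1, h2, rfl⟩
    exact ⟨e, he, (toSet_subset_iff hn).2 hF, _, mem_vertices.2 ⟨p, hp, rfl⟩, _,
      mem_vertices.2 ⟨q, hq, rfl⟩, h1, h2, rfl⟩

theorem boundaryPoints_nonempty_iff (hn : 2 ≤ n) (h𝓜 : ∀ p : Fin d → Fin n, 𝓜 (vert p).lo ≠ 0)
    {F : GridFace d n} : (boundaryPoints 𝓜 b F).Nonempty ↔ IsMixed 𝓜 F := by
  constructor
  · rintro ⟨x, hx⟩
    obtain ⟨e, hF, -, p, q, hp, hq, h1, h2, -⟩ := (mem_boundaryPoints hn).1 hx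
    exact ⟨p, q, hp.trans hF, hq.trans hF, h1, h2⟩
  · intro h
    obtain ⟨e, hF, he, p, q, hp, hq, h1, h2⟩ := h.exists_edge h𝓜
    exact ⟨_, (mem_boundaryPoints hn).2 ⟨e, hF, he, p, q, hp, hq, h1, h2, rfl⟩⟩

theorem boundaryPoint_mem_relint (hn : 2 ≤ n) (hb : IsBoundaryPointMap n ne 𝓜 b)
    {e : GridFace d n} (he : e.dim = 1) {p q : Fin d → Fin n} (hp : vert p ≤ e) (hq : vert q ≤ e)
    (h1 : 𝓜 (vert p).lo = -1) (h2 : 𝓜 (vert q).lo = 1) :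
    b (vert p).lo (vert q).lo ∈ e.relint := by
  have hε := eps_pos hn
  obtain ⟨i, hi, -, -, h⟩ := hb e he _ (mem_vertices.2 ⟨p, hp, rfl⟩) _
    (mem_vertices.2 ⟨q, hq, rfl⟩) h1 h2
  have hne0 : (0 : ℝ) < ne := by exact_mod_cast (Nat.zero_le i).trans_lt hi
  have hi' : (i : ℝ) + 1 ≤ ne := by exact_mod_cast hi
  -- The half step gives `0 < s < 1`, so that even for the first and last subintervals the boundary
  -- point is not an end of the edge.
  set s : ℝ := ((i : ℝ) + 1 / 2) / ne with hs
  have hs0 : 0 < s := by positivity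
  have hs1 : s < 1 := by rw [hs, div_lt_one hne0]; linarith
  rw [h]
  obtain ⟨a, ha⟩ := Finset.card_eq_one.1 he
  have hout : ∀ k, k ∉ e.dirs → (p k : ℕ) = e.base k ∧ (q k : ℕ) = e.base k :=
    fun k hk => ⟨base_eq_of_notMem hp hk, base_eq_of_notMem hq hk⟩
  have hpq : (p a : ℕ) ≠ q a := by
    intro hpq
    have : p = q := by
      funext k
      by_cases hk : k = a
      · rw [hk]; exact Fin.ext hpq
      · have := hout k (by rw [ha]; simpa using hk)
        exact Fin.ext (by omega)
    rw [this, h2] at h1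
    exact absurd h1 (by decide)
  intro k
  simp only [Pi.add_apply, Pi.smul_apply, Pi.sub_apply, smul_eq_mul, lo_apply, vert_base]
  refine ⟨fun hk => ?_, fun hk => ?_⟩
  · have hka : k = a := by rw [ha] at hk; simpa using hk
    subst hka
    rw [hi_of_mem hk]
    rcases base_eq_or hp k with h3 | h3 <;> rcases base_eq_or hq k with h4 | h4 <;>
      simp only [vert_base] at h3 h4
    · omega
    · rw [h3, h4]
      push_cast
      constructor <;> nlinarith
    · rw [h3, h4]
      push_cast
      constructor <;> nlinarith
    · omega
  · rw [(hout k hk).1, (hout k hk).2, sub_self, mul_zero, add_zero]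

theorem boundaryPoints_subset (hn : 2 ≤ n) (hb : IsBoundaryPointMap n ne 𝓜 b) (F : GridFace d n) :
    boundaryPoints 𝓜 b F ⊆ F.toSet := by
  intro x hx
  obtain ⟨e, hF, he, p, q, hp, hq, h1, h2, rfl⟩ := (mem_boundaryPoints hn).1 hx
  exact (toSet_subset_iff hn).2 hF (relint_subset hn _
    (boundaryPoint_mem_relint hn hb he hp hq h1 h2))

theorem boundaryPoints_mono {F G : GridFace d n} (hn : 2 ≤ n) (h : F ≤ G) :
    boundaryPoints 𝓜 b F ⊆ boundaryPoints 𝓜 b G := by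
  rintro x ⟨e, he, hF, H⟩
  exact ⟨e, he, hF.trans ((toSet_subset_iff hn).2 h), H⟩

/-- The point from which a mixed face is projected. -/
abbrev centre (𝓜 : E d → SignType) (b : E d → E d → E d) (F : GridFace d n) : E d :=
  barycentre (boundaryPoints 𝓜 b F)

/-- All boundary points lie in `F`, so in each direction `j` it is enough to find one off each of
the two facets orthogonal to `j`. A mixed edge along `j` has a point off both; otherwise both facets
are mixed and each provides a point off the other. -/
theorem centre_mem_relint (hn : 2 ≤ n) (h𝓜 : ∀ p : Fin d → Fin n, 𝓜 (vert p).lo ≠ 0)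
    (hb : IsBoundaryPointMap n ne 𝓜 b) {F : GridFace d n} (hF : IsMixed 𝓜 F) :
    centre 𝓜 b F ∈ F.relint := by
  have hfin := finite_boundaryPoints 𝓜 b F
  have hsub := boundaryPoints_subset (𝓜 := 𝓜) hn hb F
  have hε := eps_pos hn
  intro j
  refine ⟨fun hj => ?_, fun hj => ?_⟩
  · have hl : ∀ x ∈ boundaryPoints 𝓜 b F, F.lo j ≤ x j := fun x hx => (mem_toSet.1 (hsub hx) j).1
    have hu : ∀ x ∈ boundaryPoints 𝓜 b F, x j ≤ F.hi j := fun x hx => (mem_toSet.1 (hsub hx) j).2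
    rcases hF.edge_or_facets h𝓜 hj with ⟨e, heF, he, hje, p, q, hp, hq, h1, h2⟩ | ⟨h1, h2⟩
    · have hx : b (vert p).lo (vert q).lo ∈ boundaryPoints 𝓜 b F :=
        (mem_boundaryPoints hn).2 ⟨e, heF, he, p, q, hp, hq, h1, h2, rfl⟩
      have h := (boundaryPoint_mem_relint hn hb he hp hq h1 h2 j).1 hje
      rw [lo_apply, hi_of_mem hje, base_eq_of_mem heF hje, ← lo_apply, ← hi_of_mem hj] at h
      exact ⟨lt_barycentre_apply hfin hl ⟨_, hx, h.1⟩, barycentre_apply_lt hfin hu ⟨_, hx, h.2⟩⟩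
    · obtain ⟨x, hx⟩ := (boundaryPoints_nonempty_iff (b := b) hn h𝓜).2 h1
      obtain ⟨y, hy⟩ := (boundaryPoints_nonempty_iff (b := b) hn h𝓜).2 h2
      have hxj := mem_toSet.1 (boundaryPoints_subset hn hb _ hx) j
      have hyj := mem_toSet.1 (boundaryPoints_subset hn hb _ hy) j
      rw [lo_apply, hi_apply, facet_len_self, facet_base_self] at hxj hyj
      push_cast at hxj hyj
      refine ⟨lt_barycentre_apply hfin hl
        ⟨y, boundaryPoints_mono hn (facet_succ_le hj) hy, lt_of_lt_of_le ?_ hyj.1⟩,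
        barycentre_apply_lt hfin hu
        ⟨x, boundaryPoints_mono hn (facet_base_le F j) hx, hxj.2.trans_lt ?_⟩⟩
      · rw [lo_apply]
        gcongr
        linarith
      · rw [hi_of_mem hj]
        gcongr
        linarith
  · refine barycentre_apply_eq hfin ((boundaryPoints_nonempty_iff hn h𝓜).2 hF) fun x hx => ?_
    have h := mem_toSet.1 (hsub hx) j
    rw [hi_of_notMem hj] at h
    exact le_antisymm h.2 h.1

theorem centre_injective (hn : 2 ≤ n) (h𝓜 : ∀ p : Fin d → Fin n, 𝓜 (vert p).lo ≠ 0)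
    (hb : IsBoundaryPointMap n ne 𝓜 b) {F G : GridFace d n} (hF : IsMixed 𝓜 F)
    (hG : IsMixed 𝓜 G) (h : centre 𝓜 b F = centre 𝓜 b G) : F = G :=
  eq_of_mem_relint hn (centre_mem_relint hn h𝓜 hb hF) (h ▸ centre_mem_relint hn h𝓜 hb hG)

/-! ### The simplices of the resistar and its boundary -/

theorem isFlag_iff (hn : 2 ≤ n) {C : GridFace d n} {h : ℕ} {F : ℕ → GridFace d n} :
    IsFlag C h F ↔ F d = C ∧ GridFace.IsChain h d F := by
  simp only [IsFlag, GridFace.IsChain, toSet_subset_iff hn]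

theorem mem_X_diff_frontier {x : E d} :
    x ∈ X d \ frontier (X d) ↔ ∀ i, 0 < x i ∧ x i < 1 := by
  rw [self_sdiff_frontier, X, ← Set.pi_univ_Icc, interior_pi_set Set.finite_univ]
  simp [interior_Icc]

theorem GridFace.IsChain.update {l m i : ℕ} {F : ℕ → GridFace d n} (H : GridFace.IsChain l m F)
    {G : GridFace d n} (hd : G.dim = i) (h : l < i → F (i - 1) ≤ G) (h' : i < m → G ≤ F (i + 1)) :
    GridFace.IsChain l m (Function.update F i G) := by
  refine ⟨fun j hj hj' => ?_, fun j hj hj' => ?_⟩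
  · by_cases hji : j = i
    · rw [hji, Function.update_self, hd]
    · rw [Function.update_of_ne hji]
      exact H.1 j hj hj'
  · by_cases hji : j = i
    · subst hji
      rw [Function.update_self, Function.update_of_ne (by omega)]
      exact h' hj'
    · rw [Function.update_of_ne hji]
      by_cases hji' : j + 1 = i
      · subst hji'
        rw [Function.update_self]
        exact h (by omega)
      · rw [Function.update_of_ne hji']
        exact H.2 j hj hj'

theorem mem_gridResistarSimplices (hd : 1 ≤ d) (hn : 2 ≤ n)
    (h𝓜 : ∀ p : Fin d → Fin n, 𝓜 (vert p).lo ≠ 0) {S : Set (E d)} :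
    S ∈ gridResistarSimplices n 𝓜 b ↔ ∃ F : ℕ → GridFace d n, GridFace.IsChain 1 d F ∧
      IsMixed 𝓜 (F 1) ∧ S = (fun i => centre 𝓜 b (F i)) '' Set.Icc 1 d := by
  constructor
  · rintro ⟨C, -, -, F, hF, h1, rfl⟩
    exact ⟨F, ((isFlag_iff hn).1 hF).2, (boundaryPoints_nonempty_iff hn h𝓜).1 h1, rfl⟩
  · rintro ⟨F, hF, h1, rfl⟩
    exact ⟨F d, hF.1 d hd le_rfl,
      (boundaryPoints_nonempty_iff hn h𝓜).2 (h1.mono (hF.le le_rfl hd le_rfl)), F,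
      (isFlag_iff hn).2 ⟨rfl, hF⟩, (boundaryPoints_nonempty_iff hn h𝓜).2 h1, rfl⟩

theorem mem_gridResistar (hd : 1 ≤ d) (hn : 2 ≤ n)
    (h𝓜 : ∀ p : Fin d → Fin n, 𝓜 (vert p).lo ≠ 0) {x : E d} :
    x ∈ gridResistar n 𝓜 b ↔ ∃ F : ℕ → GridFace d n, GridFace.IsChain 1 d F ∧
      IsMixed 𝓜 (F 1) ∧ x ∈ centreHull (centre 𝓜 b) F 1 d := by
  simp only [gridResistar, Set.mem_iUnion, mem_gridResistarSimplices hd hn h𝓜]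
  constructor
  · rintro ⟨S, ⟨F, h1, h2, rfl⟩, hx⟩
    exact ⟨F, h1, h2, hx⟩
  · rintro ⟨F, h1, h2, hx⟩
    exact ⟨_, ⟨F, h1, h2, rfl⟩, hx⟩

theorem isMixed_of_isChain {l m : ℕ} {F : ℕ → GridFace d n} (H : GridFace.IsChain l m F)
    (hF : IsMixed 𝓜 (F l)) : ∀ i ∈ Set.Icc l m, IsMixed 𝓜 (F i) :=
  fun _ hi => hF.mono (H.le le_rfl hi.1 hi.2)

theorem eq_of_centre_eq (hn : 2 ≤ n) (h𝓜 : ∀ p : Fin d → Fin n, 𝓜 (vert p).lo ≠ 0)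
    (hb : IsBoundaryPointMap n ne 𝓜 b) {l m : ℕ} {F G : ℕ → GridFace d n}
    (HF : GridFace.IsChain l m F) (hF : IsMixed 𝓜 (F l)) (HG : GridFace.IsChain l m G)
    (hG : IsMixed 𝓜 (G l)) {i j : ℕ} (hi : i ∈ Set.Icc l m) (hj : j ∈ Set.Icc l m)
    (h : centre 𝓜 b (F i) = centre 𝓜 b (G j)) : i = j ∧ F i = G j := by
  have h1 := centre_injective hn h𝓜 hb (isMixed_of_isChain HF hF i hi)
    (isMixed_of_isChain HG hG j hj) h
  refine ⟨?_, h1⟩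
  rw [← HF.1 i hi.1 hi.2, ← HG.1 j hj.1 hj.2, h1]

/-- The simplices correspond to chains, and a facet to a chain with the face of one dimension `i`
deleted. Inside the domain the gap can always be filled in a second way, so the facet is shared. -/
theorem notMem_interior_of_mem_gridResistarBoundary (hd : 1 ≤ d) (hn : 2 ≤ n)
    (h𝓜 : ∀ p : Fin d → Fin n, 𝓜 (vert p).lo ≠ 0) (hb : IsBoundaryPointMap n ne 𝓜 b) {x : E d}
    (hx : x ∈ gridResistarBoundary n 𝓜 b) : x ∉ X d \ frontier (X d) := by
  rw [mem_X_diff_frontier]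
  intro hint
  obtain ⟨S, hS, p, hp, huniq, hx⟩ := hx
  obtain ⟨F, HF, hF1, rfl⟩ := (mem_gridResistarSimplices hd hn h𝓜).1 hS
  obtain ⟨i, hi, rfl⟩ := hp
  -- An unshared facet forces every admissible replacement of `F i` to be `F i` itself.
  have no_other : ∀ G : GridFace d n, G.dim = i → (1 < i → F (i - 1) ≤ G) →
      (i < d → G ≤ F (i + 1)) → (i = 1 → IsMixed 𝓜 G) → G = F i := by
    intro G hdim h h' hmix
    have H := HF.update hdim h h'
    have hF1' : IsMixed 𝓜 (Function.update F i G 1) := by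
      by_cases h1 : 1 = i
      · rw [← h1, Function.update_self]
        exact hmix h1.symm
      · rwa [Function.update_of_ne h1]
    have hS' := huniq _ ((mem_gridResistarSimplices hd hn h𝓜).2 ⟨_, H, hF1', rfl⟩) (by
      rintro _ ⟨⟨j, hj, rfl⟩, hj'⟩
      have hji : j ≠ i := by rintro rfl; exact hj' rfl
      exact ⟨j, hj, by simp only [Function.update_of_ne hji]⟩)
    obtain ⟨j, hj, h1⟩ := hS'.subset ⟨i, hi, rfl⟩
    have h2 := eq_of_centre_eq hn h𝓜 hb HF hF1 H hF1' hj hi h1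
    obtain ⟨rfl, h2⟩ := h2
    rw [h2, Function.update_self]
  -- Three ways to refill the gap: for `1 < i < d`, another face between `F (i - 1)` and `F (i +
  -- 1)`; for `i = 1 < d`, another mixed edge of the square `F 2`; for `i = d`, the cube on the
  -- other side of `F (d - 1)`.
  rcases hi.2.lt_or_eq with hid | rfl
  · rcases hi.1.lt_or_eq with h1i | rfl
    · obtain ⟨j, hj, hj'⟩ : ∃ j ∈ (F (i + 1)).dirs, j ∉ (F i).dirs := by
        refine Finset.not_subset.1 fun h => ?_
        have h1 := Finset.card_le_card h
        have h2 : (F (i + 1)).dirs.card = i + 1 := HF.1 (i + 1) (by omega) hid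
        have h3 : (F i).dirs.card = i := HF.1 i hi.1 hi.2
        omega
      have hsub := HF.le (i := i - 1) (j := i) (by omega) (by omega) hi.2
      obtain ⟨G, h1, h2, h3, h4⟩ := exists_between (hsub.trans (HF.2 i hi.1 hid)) hj
        fun h => hj' (dirs_subset hsub h)
      rw [HF.1 (i - 1) (by omega) (by omega)] at h4
      have := no_other G (by omega) (fun _ => h1) (fun _ => h2) (by omega)
      exact hj' (this ▸ h3)
    · obtain ⟨G, h1, h2, h3, h4⟩ := IsMixed.exists_ne_edge h𝓜 (HF.1 1 le_rfl hd)
        (HF.1 2 (by omega) hid) (hF1.mono (HF.2 1 le_rfl hid))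
      exact h3 (no_other G h2 (by omega) (fun _ => h1) fun _ => h4)
  · have hsub : (fun j => centre 𝓜 b (F j)) '' Set.Icc 1 i \ {centre 𝓜 b (F i)} ⊆
        (fun j => centre 𝓜 b (F j)) '' Set.Icc 1 (i - 1) := by
      rintro _ ⟨⟨j, hj, rfl⟩, hj'⟩
      have hji : j ≠ i := by rintro rfl; exact hj' rfl
      have := hj.2
      exact ⟨j, ⟨hj.1, by omega⟩, rfl⟩
    have hx' : x ∈ centreHull (centre 𝓜 b) F 1 (i - 1) := convexHull_mono hsub hx
    -- In dimension one the facet of a simplex is empty.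
    rcases hi.1.eq_or_lt with rfl | h1i
    · rw [centreHull_of_lt F (by omega)] at hx'
      exact hx'
    have H' := HF.mono le_rfl (Nat.sub_le i 1)
    have hxF := centreHull_subset hn (N := IsMixed 𝓜) (fun F hF => centre_mem_relint hn h𝓜 hb hF)
      H' (isMixed_of_isChain H' hF1) hx'
    have hle := HF.le (i := i - 1) (j := i) (by omega) (by omega) le_rfl
    obtain ⟨j, -, hj⟩ : ∃ j ∈ (F i).dirs, j ∉ (F (i - 1)).dirs := by
      refine Finset.not_subset.1 fun h => ?_
      have h1 := Finset.card_le_card h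
      have h2 : (F i).dirs.card = i := HF.1 i hi.1 le_rfl
      have h3 : (F (i - 1)).dirs.card = i - 1 := HF.1 (i - 1) (by omega) (by omega)
      omega
    have hcube := dirs_eq_univ (HF.1 i hi.1 le_rfl)
    have hxj := mem_toSet.1 hxF j
    rw [hi_of_notMem hj, lo_apply] at hxj
    have hxj' := le_antisymm hxj.2 hxj.1
    have h0 : ((F (i - 1)).base j : ℕ) ≠ 0 := by
      intro h0
      rw [h0, Nat.cast_zero, zero_mul] at hxj'
      exact (hint j).1.ne' hxj'
    have hlast : ((F (i - 1)).base j : ℕ) + 1 ≠ n := by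
      intro h1
      have h2 : (((F (i - 1)).base j : ℕ) : ℝ) + 1 = n := by exact_mod_cast h1
      replace h2 := eq_sub_of_add_eq h2
      rw [h2, sub_one_mul_eps hn] at hxj'
      exact (hint j).2.ne hxj'
    have hlt := ((F (i - 1)).base j).2
    have hcj := hle j
    rw [len_of_notMem hj, len_of_mem (hcube ▸ Finset.mem_univ j)] at hcj
    -- A cube containing `F (i - 1)` has as base index along `j` that of this face or the one just
    -- below. As `x` is interior to the domain, both are available, and `k` is the one not used by
    -- `F i`.
    obtain ⟨k, hk, hk1, hk2⟩ : ∃ k : Fin n, k ≠ (F i).base j ∧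
        (k : ℕ) ≤ (F (i - 1)).base j ∧ ((F (i - 1)).base j : ℕ) ≤ k + 1 := by
      by_cases h : (F i).base j = (F (i - 1)).base j
      · refine ⟨⟨(F (i - 1)).base j - 1, by omega⟩, fun hk => ?_, ?_, ?_⟩
        · rw [h] at hk
          have := congrArg Fin.val hk
          simp only at this
          omega
        · simp
        · simp only; omega
      · exact ⟨_, fun hk => h hk.symm, le_rfl, Nat.le_succ _⟩
    have hG := no_other ⟨Function.update (F i).base j k, Finset.univ, fun l _ => ?_⟩
      (Finset.card_fin i) (fun _ l => ?_) (by omega) (by omega)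
    · have := congrArg (fun G : GridFace i n => G.base j) hG
      simp only [Function.update_self] at this
      exact hk this
    · by_cases hl : l = j
      · subst hl
        rw [Function.update_self]
        omega
      · rw [Function.update_of_ne hl]
        exact (F i).bound l (hcube ▸ Finset.mem_univ l)
    · by_cases hl : l = j
      · subst hl
        simpa [len, hj] using And.intro hk1 hk2
      · simpa [len, hl, hcube] using hle l

/-- The face whose relative interior contains `x` lies in a hyperplane bounding the domain.
Completing its chain through a cube facet `H` in this hyperplane gives a simplex whose facet
opposite the centre of the cube contains `x` and is unshared, since `H` belongs to a single cube. -/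
theorem mem_gridResistarBoundary (hd : 1 ≤ d) (hn : 2 ≤ n)
    (h𝓜 : ∀ p : Fin d → Fin n, 𝓜 (vert p).lo ≠ 0) (hb : IsBoundaryPointMap n ne 𝓜 b) {x : E d}
    (hx : x ∈ gridResistar n 𝓜 b) (hx' : x ∉ X d \ frontier (X d)) :
    x ∈ gridResistarBoundary n 𝓜 b := by
  have hε := eps_pos hn
  have hc : ∀ F : GridFace d n, IsMixed 𝓜 F → centre 𝓜 b F ∈ F.relint :=
    fun F hF => centre_mem_relint hn h𝓜 hb hF
  rw [mem_X_diff_frontier] at hx'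
  obtain ⟨F, HF, hF1, hxF⟩ := (mem_gridResistar hd hn h𝓜).1 hx
  obtain ⟨k, hk, hr, hxk⟩ :=
    exists_mem_relint_of_mem_centreHull hn hc HF (isMixed_of_isChain HF hF1) hxF
  obtain ⟨i, hiF, hi⟩ : ∃ i, i ∉ (F k).dirs ∧
      (((F k).base i : ℕ) = 0 ∨ ((F k).base i : ℕ) + 1 = n) := by
    push Not at hx'
    obtain ⟨i, hi⟩ := hx'
    have hlt := (F k).base_add_len_lt i
    have hlo : 0 ≤ (F k).lo i := by rw [lo_apply]; positivity
    have hhi : (F k).hi i ≤ 1 := by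
      rw [hi_apply, ← sub_one_mul_eps hn]
      gcongr
      have : ((F k).base i : ℝ) + (F k).len i + 1 ≤ n := by exact_mod_cast hlt
      linarith
    by_cases hiF : i ∈ (F k).dirs
    · have h := (hr i).1 hiF
      have := hi (hlo.trans_lt h.1)
      linarith
    · refine ⟨i, hiF, ?_⟩
      have h := (hr i).2 hiF
      by_contra! hcon
      have h0 : 0 < x i := by
        rw [h, lo_apply]
        have : 0 < ((F k).base i : ℕ) := by omega
        positivity
      have h1 := hi h0
      rw [h, lo_apply, ← sub_one_mul_eps hn, mul_le_mul_iff_left₀ hε] at h1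
      have h2 : (n : ℝ) ≤ ((F k).base i : ℕ) + 1 := by linarith
      have h3 : n ≤ ((F k).base i : ℕ) + 1 := by exact_mod_cast h2
      omega
  obtain ⟨C, hC, hFC⟩ := exists_cube_ge hn (F k)
  have hCu := dirs_eq_univ hC
  have hiC : i ∈ C.dirs := hCu ▸ Finset.mem_univ i
  have hFi := hFC i
  rw [len_of_notMem hiF] at hFi
  set H := C.facet i ((F k).base i) with hH
  have hHd : H.dim + 1 = d := (facet_dim hiC _).trans hC
  have hHC : H ≤ C := facet_le hFi.1 hFi.2
  have hFH : F k ≤ H := le_facet hFC rfl hiF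
  obtain ⟨F', HF', hF'H, hF'⟩ := (HF.mono le_rfl hk.2).exists_extend hk.1 hFH
  have hkH : k ≤ H.dim := by
    have := dim_le hFH
    rwa [HF.1 k hk.1 hk.2] at this
  have HG := HF'.snoc (hk.1.trans hkH) (hF'H.le.trans hHC) (hC.trans hHd.symm)
  rw [hHd] at HG
  set G := Function.update F' d C with hG
  have hGH : G H.dim = H := by rw [hG, Function.update_of_ne (by omega), hF'H]
  have hGd : G d = C := Function.update_self ..
  -- The new chain agrees with the old one up to `k`, so `x` is still in the hull of its first `k`
  -- centres, all different from that of the cube.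
  have hGF : ∀ j ≤ k, G j = F j := fun j hj => by
    rw [hG, Function.update_of_ne (by omega), hF' j hj]
  have hG1 : IsMixed 𝓜 (G 1) := by rwa [hGF 1 hk.1]
  have hdd : d ∈ Set.Icc 1 d := ⟨hd, le_rfl⟩
  have hne : ∀ j ∈ Set.Icc 1 d, j ≠ d → centre 𝓜 b (G j) ≠ centre 𝓜 b (G d) :=
    fun j hj hjd h => hjd (eq_of_centre_eq hn h𝓜 hb HG hG1 HG hG1 hj hdd h).1
  refine ⟨_, (mem_gridResistarSimplices hd hn h𝓜).2 ⟨G, HG, hG1, rfl⟩, centre 𝓜 b (G d),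
    ⟨d, hdd, rfl⟩, ?_, ?_⟩
  · intro S' hS' hsub
    obtain ⟨G', HG', hG1', rfl⟩ := (mem_gridResistarSimplices hd hn h𝓜).1 hS'
    have hkd := hk.1
    have heq : ∀ j ∈ Set.Icc 1 d, j ≠ d → G' j = G j := by
      intro j hj hjd
      obtain ⟨l, hl, h⟩ := hsub ⟨⟨j, hj, rfl⟩, hne j hj hjd⟩
      have h1 := eq_of_centre_eq hn h𝓜 hb HG' hG1' HG hG1 hl hj h
      rw [← h1.2, h1.1]
    -- Along the directions of `H` the base of a cube containing `H` is that of `H`. Along `i` the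
    -- index of `H` is extreme, which leaves only one side.
    have hlast : G' d = G d := by
      have h1 : H ≤ G' d := by
        rw [← hGH, ← heq H.dim ⟨by omega, by omega⟩ (by omega)]
        exact HG'.le (by omega) (by omega) le_rfl
      rw [hGd]
      have hu := dirs_eq_univ (HG'.1 d hd le_rfl)
      refine ext' (fun j => ?_) (by rw [hu, hCu])
      by_cases hj : j ∈ H.dirs
      · rw [← base_eq_of_mem h1 hj, base_eq_of_mem hHC hj]
      · have hji : j = i := by
          by_contra hji
          exact hj (Finset.mem_erase.2 ⟨hji, hCu ▸ Finset.mem_univ j⟩)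
        subst hji
        have h2 := h1 j
        have h3 := (G' d).bound j (hu ▸ Finset.mem_univ j)
        have h4 := C.bound j hiC
        rw [hH, facet_base_self, facet_len_self, len_of_mem (hu ▸ Finset.mem_univ j)] at h2
        rw [len_of_mem hiC] at hFi
        omega
    refine Set.image_congr fun j hj => ?_
    by_cases hjd : j = d
    · rw [hjd, hlast]
    · rw [heq j hj hjd]
  · refine convexHull_mono ?_ hxk
    rintro _ ⟨j, hj, rfl⟩
    have := hj.2
    have hj' : j ∈ Set.Icc 1 d := ⟨hj.1, by omega⟩
    have h1 := hne j hj' (by omega)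
    rw [hGF j hj.2] at h1
    exact ⟨⟨j, hj', by simp only [hGF j hj.2]⟩, h1⟩

/-! ### Components and their classification sets -/

instance : Finite (GridFace d n) := GridFace.finite_gridFace

theorem mem_emptyFaces (hn : 2 ≤ n) (h𝓜 : ∀ p : Fin d → Fin n, 𝓜 (vert p).lo ≠ 0) {x : E d} :
    x ∈ emptyFaces n 𝓜 b ↔ ∃ F : GridFace d n, ¬ IsMixed 𝓜 F ∧ x ∈ F.toSet := by
  simp only [emptyFaces, Set.mem_iUnion, Set.mem_ofPred_eq, ← boundaryPoints_nonempty_iff (b := b)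
    hn h𝓜, Set.not_nonempty_iff_eq_empty, exists_prop]

theorem toSet_subset_emptyFaces (hn : 2 ≤ n) (h𝓜 : ∀ p : Fin d → Fin n, 𝓜 (vert p).lo ≠ 0)
    {F : GridFace d n} (hF : ¬ IsMixed 𝓜 F) : F.toSet ⊆ emptyFaces n 𝓜 b :=
  fun _ hx => (mem_emptyFaces hn h𝓜).2 ⟨F, hF, hx⟩

/-- A face containing the centre of a mixed face contains that whole face and is thus mixed; so the
centre lies in no non-mixed face. -/
theorem not_isMixed_of_subset (hn : 2 ≤ n) (h𝓜 : ∀ p : Fin d → Fin n, 𝓜 (vert p).lo ≠ 0)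
    (hb : IsBoundaryPointMap n ne 𝓜 b) {F : GridFace d n} (hF : F.toSet ⊆ emptyFaces n 𝓜 b) :
    ¬ IsMixed 𝓜 F := by
  intro hm
  have hc := centre_mem_relint hn h𝓜 hb hm
  obtain ⟨G, hG, hcG⟩ := (mem_emptyFaces hn h𝓜).1 (hF (relint_subset hn F hc))
  exact hG (hm.mono (le_of_mem_relint hn hc hcG))

theorem components_subset {D : Set (E d)} (hD : D ∈ components n 𝓜 b) :
    D ⊆ emptyFaces n 𝓜 b := by
  obtain ⟨x, -, rfl⟩ := hD
  exact connectedComponentIn_subset _ _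

theorem isConnected_of_mem_components {D : Set (E d)} (hD : D ∈ components n 𝓜 b) :
    IsConnected D := by
  obtain ⟨x, hx, rfl⟩ := hD
  exact isConnected_connectedComponentIn_iff.2 hx

theorem eq_connectedComponentIn {D : Set (E d)} (hD : D ∈ components n 𝓜 b) {x : E d}
    (hx : x ∈ D) : D = connectedComponentIn (emptyFaces n 𝓜 b) x := by
  obtain ⟨y, -, rfl⟩ := hD
  exact connectedComponentIn_eq hx

theorem toSet_subset_component (hn : 2 ≤ n) (h𝓜 : ∀ p : Fin d → Fin n, 𝓜 (vert p).lo ≠ 0)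
    {D : Set (E d)} (hD : D ∈ components n 𝓜 b) {F : GridFace d n} (hF : ¬ IsMixed 𝓜 F)
    {x : E d} (hx : x ∈ F.toSet) (hxD : x ∈ D) : F.toSet ⊆ D := by
  rw [eq_connectedComponentIn hD hxD]
  exact F.convex_toSet.isPreconnected.subset_connectedComponentIn hx
    (toSet_subset_emptyFaces hn h𝓜 hF)

theorem exists_component (hn : 2 ≤ n) (h𝓜 : ∀ p : Fin d → Fin n, 𝓜 (vert p).lo ≠ 0)
    {F : GridFace d n} (hF : ¬ IsMixed 𝓜 F) : ∃ D ∈ components n 𝓜 b, F.toSet ⊆ D := by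
  have hlo := toSet_subset_emptyFaces (b := b) hn h𝓜 hF (F.lo_mem hn)
  have hD : connectedComponentIn (emptyFaces n 𝓜 b) F.lo ∈ components n 𝓜 b := ⟨_, hlo, rfl⟩
  exact ⟨_, hD, toSet_subset_component hn h𝓜 hD hF (F.lo_mem hn) (mem_connectedComponentIn hlo)⟩

theorem finite_components (hn : 2 ≤ n) (h𝓜 : ∀ p : Fin d → Fin n, 𝓜 (vert p).lo ≠ 0) :
    (components n 𝓜 b).Finite := by
  refine (Set.finite_range fun F : GridFace d n =>
    connectedComponentIn (emptyFaces n 𝓜 b) F.lo).subset ?_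
  rintro D hD
  obtain ⟨x, hx⟩ := (isConnected_of_mem_components hD).nonempty
  obtain ⟨F, hF, hxF⟩ := (mem_emptyFaces hn h𝓜).1 (components_subset hD hx)
  exact ⟨F, (eq_connectedComponentIn hD
    (toSet_subset_component hn h𝓜 hD hF hxF hx (F.lo_mem hn))).symm⟩

/-- All grid points of a component have the same label. -/
theorem component_sign (hn : 2 ≤ n) (h𝓜 : ∀ p : Fin d → Fin n, 𝓜 (vert p).lo ≠ 0)
    {D : Set (E d)} (hD : D ∈ components n 𝓜 b) {p q : Fin d → Fin n}
    (hp : (vert p).lo ∈ D) (hq : (vert q).lo ∈ D) (h1 : 𝓜 (vert p).lo = -1)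
    (h2 : 𝓜 (vert q).lo = 1) : False := by
  -- `U (-1)` and `U 1` are closed and cover `D`. If `D` met both, connectedness would give a common
  -- point; the face with this point in its relative interior is part of a non-mixed face of each
  -- label, a contradiction.
  let U : SignType → Set (E d) := fun s =>
    ⋃ F ∈ {F : GridFace d n | ¬ IsMixed 𝓜 F ∧ 𝓜 (vert F.base).lo = s}, F.toSet
  have hmem : ∀ {s x}, x ∈ U s ↔
      ∃ F : GridFace d n, (¬ IsMixed 𝓜 F ∧ 𝓜 (vert F.base).lo = s) ∧ x ∈ F.toSet := by
    intro s x
    simp only [U, Set.mem_iUnion, Set.mem_ofPred_eq, exists_prop]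
  have hclosed : ∀ s, IsClosed (U s) := fun s =>
    (Set.toFinite _).isClosed_biUnion fun F _ => F.isClosed_toSet
  have hvert : ∀ r : Fin d → Fin n, (vert r).lo ∈ U (𝓜 (vert r).lo) := fun r =>
    hmem.2 ⟨vert r, ⟨not_isMixed_of_dim_eq_zero rfl, rfl⟩, lo_mem hn _⟩
  have hcover : D ⊆ U (-1) ∪ U 1 := by
    intro x hx
    obtain ⟨F, hF, hxF⟩ := (mem_emptyFaces hn h𝓜).1 (components_subset hD hx)
    have h0 := h𝓜 F.base
    rcases SignType.trichotomy (𝓜 (vert F.base).lo) with h | h | h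
    · exact Or.inl (hmem.2 ⟨F, ⟨hF, h⟩, hxF⟩)
    · exact absurd h h0
    · exact Or.inr (hmem.2 ⟨F, ⟨hF, h⟩, hxF⟩)
  obtain ⟨x, -, hx1, hx2⟩ := isPreconnected_closed_iff.1
    (isConnected_of_mem_components hD).isPreconnected _ _ (hclosed (-1)) (hclosed 1) hcover
    ⟨_, hp, h1 ▸ hvert p⟩ ⟨_, hq, h2 ▸ hvert q⟩
  obtain ⟨F, ⟨hF, hF1⟩, hxF⟩ := hmem.1 hx1
  obtain ⟨G, ⟨hG, hG1⟩, hxG⟩ := hmem.1 hx2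
  obtain ⟨H, hH⟩ := exists_mem_relint hn (toSet_subset_X hn F hxF)
  have key : ∀ F' : GridFace d n, ¬ IsMixed 𝓜 F' → x ∈ F'.toSet →
      𝓜 (vert H.base).lo = 𝓜 (vert F'.base).lo := by
    intro F' hF' hx
    by_contra hne
    exact hF' (isMixed_of_ne h𝓜 ((vert_base_le H).trans (le_of_mem_relint hn hH hx))
      (vert_base_le F') hne)
  have := (key F hF hxF).symm.trans (key G hG hxG)
  rw [hF1, hG1] at this
  exact absurd this (by decide)

/-- The case distinction of the definition is absorbed: a cube contained in `D` is not mixed, so it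
carries no chain ending above a mixed face, and a chain with `F h` in `D` makes `D` meet the cube.
-/
theorem mem_gridClassificationSet (hn : 2 ≤ n)
    (h𝓜 : ∀ p : Fin d → Fin n, 𝓜 (vert p).lo ≠ 0) (hb : IsBoundaryPointMap n ne 𝓜 b)
    {D : Set (E d)} (hD : D ∈ components n 𝓜 b) {x : E d} :
    x ∈ gridClassificationSet n 𝓜 b D ↔
      (∃ C : GridFace d n, C.dim = d ∧ C.toSet ⊆ D ∧ x ∈ C.toSet) ∨
      ∃ (h : ℕ) (F : ℕ → GridFace d n), h < d ∧ GridFace.IsChain h d F ∧ ¬ IsMixed 𝓜 (F h) ∧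
        IsMixed 𝓜 (F (h + 1)) ∧ (F h).toSet ⊆ D ∧
        x ∈ convexHull ℝ ((F h).vertices ∪
          (fun i => centre 𝓜 b (F i)) '' Set.Icc (h + 1) d) := by
  simp only [gridClassificationSet, Set.mem_iUnion, Set.mem_ofPred_eq, exists_prop]
  constructor
  · rintro ⟨C, hC, hx⟩
    unfold cubeClassificationSet at hx
    split_ifs at hx with h1 h2
    · exact hx.elim
    · exact Or.inl ⟨C, hC, Set.inter_eq_right.1 h2, hx⟩
    · obtain ⟨h, hh, F, hF, hFD, hm, hx⟩ := hx
      have hFD' := hFD.trans Set.inter_subset_left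
      exact Or.inr ⟨h, F, hh, ((isFlag_iff hn).1 hF).2,
        not_isMixed_of_subset hn h𝓜 hb (hFD'.trans (components_subset hD)),
        (boundaryPoints_nonempty_iff hn h𝓜).1 hm, hFD', hx⟩
  · rintro (⟨C, hC, hCD, hx⟩ | ⟨h, F, hh, HF, hFh, hm, hFD, hx⟩)
    · refine ⟨C, hC, ?_⟩
      have h1 : D ∩ C.toSet = C.toSet := Set.inter_eq_right.2 hCD
      have h2 : C.toSet ≠ ∅ := Set.Nonempty.ne_empty ⟨x, hx⟩
      rw [cubeClassificationSet, if_neg (by rwa [h1]), if_pos h1]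
      exact hx
    · refine ⟨F d, HF.1 d hh.le le_rfl, ?_⟩
      have hsub : (F h).toSet ⊆ D ∩ (F d).toSet :=
        Set.subset_inter hFD ((toSet_subset_iff hn).2 (HF.le le_rfl hh.le le_rfl))
      rw [cubeClassificationSet, if_neg, if_neg]
      · exact ⟨h, hh, F, (isFlag_iff hn).2 ⟨rfl, HF⟩, hsub,
          (boundaryPoints_nonempty_iff hn h𝓜).2 hm, hx⟩
      · intro h1
        exact not_isMixed_of_subset hn h𝓜 hb
          ((Set.inter_eq_right.1 h1).trans (components_subset hD))
          (hm.mono (HF.le (Nat.le_succ h) hh le_rfl))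
      · exact Set.Nonempty.ne_empty ⟨_, hsub ((F h).lo_mem hn)⟩

theorem isClosed_gridClassificationSet (hn : 2 ≤ n)
    (h𝓜 : ∀ p : Fin d → Fin n, 𝓜 (vert p).lo ≠ 0) (hb : IsBoundaryPointMap n ne 𝓜 b)
    {D : Set (E d)} (hD : D ∈ components n 𝓜 b) :
    IsClosed (gridClassificationSet n 𝓜 b D) := by
  -- Chains are functions on `ℕ` with irrelevant values, so finiteness is obtained from the vertex
  -- sets, all contained in the finite set `P`.
  let P : Set (E d) := (⋃ F : GridFace d n, F.vertices) ∪
    Set.range fun F : GridFace d n => centre 𝓜 b F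
  have hP : P.Finite := (Set.finite_iUnion fun F => F.finite_vertices).union (Set.finite_range _)
  let 𝒯 : Set (Set (E d)) := {T | ∃ (h : ℕ) (F : ℕ → GridFace d n), h < d ∧
    GridFace.IsChain h d F ∧ ¬ IsMixed 𝓜 (F h) ∧ IsMixed 𝓜 (F (h + 1)) ∧ (F h).toSet ⊆ D ∧
      T = (F h).vertices ∪ (fun i => centre 𝓜 b (F i)) '' Set.Icc (h + 1) d}
  have h𝒯P : 𝒯 ⊆ 𝒫 P := by
    rintro _ ⟨h, F, -, -, -, -, -, rfl⟩
    refine Set.union_subset_union (Set.subset_iUnion (fun F : GridFace d n => F.vertices) _) ?_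
    rintro _ ⟨i, -, rfl⟩
    exact ⟨F i, rfl⟩
  have heq : gridClassificationSet n 𝓜 b D =
      (⋃ C ∈ {C : GridFace d n | C.dim = d ∧ C.toSet ⊆ D}, C.toSet) ∪
        ⋃ T ∈ 𝒯, convexHull ℝ T := by
    ext x
    rw [mem_gridClassificationSet hn h𝓜 hb hD]
    simp only [Set.mem_union, Set.mem_iUnion, Set.mem_ofPred_eq, exists_prop, and_assoc, 𝒯]
    refine or_congr_right ⟨?_, ?_⟩
    · rintro ⟨h, F, h1, h2, h3, h4, h5, hx⟩
      exact ⟨_, ⟨h, F, h1, h2, h3, h4, h5, rfl⟩, hx⟩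
    · rintro ⟨_, ⟨h, F, h1, h2, h3, h4, h5, rfl⟩, hx⟩
      exact ⟨h, F, h1, h2, h3, h4, h5, hx⟩
  rw [heq]
  exact ((Set.toFinite _).isClosed_biUnion fun C _ => C.isClosed_toSet).union
    ((hP.finite_subsets.subset h𝒯P).isClosed_biUnion fun T hT =>
      (hP.subset (h𝒯P hT)).isClosed_convexHull (𝕜 := ℝ))

theorem isClosed_gridResistar (hd : 1 ≤ d) (hn : 2 ≤ n)
    (h𝓜 : ∀ p : Fin d → Fin n, 𝓜 (vert p).lo ≠ 0) : IsClosed (gridResistar n 𝓜 b) := by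
  have hP := Set.finite_range fun F : GridFace d n => centre 𝓜 b F
  have hsub : gridResistarSimplices n 𝓜 b ⊆ {S | S ⊆ Set.range fun F : GridFace d n => centre 𝓜 b F} := by
    intro S hS
    obtain ⟨F, -, -, rfl⟩ := (mem_gridResistarSimplices hd hn h𝓜).1 hS
    rintro _ ⟨i, -, rfl⟩
    exact ⟨F i, rfl⟩
  exact (hP.finite_subsets.subset hsub).isClosed_biUnion fun S hS =>
    (hP.subset (hsub hS)).isClosed_convexHull (𝕜 := ℝ)

theorem component_subset (hn : 2 ≤ n) (h𝓜 : ∀ p : Fin d → Fin n, 𝓜 (vert p).lo ≠ 0)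
    (hb : IsBoundaryPointMap n ne 𝓜 b) {D : Set (E d)} (hD : D ∈ components n 𝓜 b) :
    D ⊆ gridClassificationSet n 𝓜 b D := by
  intro x hx
  obtain ⟨F, hF, hxF⟩ := (mem_emptyFaces hn h𝓜).1 (components_subset hD hx)
  obtain ⟨C, hC, hFC⟩ := exists_cube_ge hn F
  rw [mem_gridClassificationSet hn h𝓜 hb hD]
  by_cases hm : IsMixed 𝓜 C
  · right
    obtain ⟨G, HG, hGC, hG⟩ := (isChain_const F).exists_extend le_rfl hFC
    rw [hC] at HG hGC
    have hFd : F.dim < d := by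
      refine lt_of_le_of_ne ((dim_le hFC).trans_eq hC) fun h => hF ?_
      rwa [eq_of_le_of_dim_le hFC (by omega)]
    classical
    -- The largest index of a non-mixed face of the chain is the required `h`: the next face is
    -- mixed.
    let s := (Finset.Icc F.dim d).filter fun i => ¬ IsMixed 𝓜 (G i)
    have hs : F.dim ∈ s := by
      simp only [s, Finset.mem_filter, Finset.mem_Icc, hG _ le_rfl]
      exact ⟨⟨le_rfl, hFd.le⟩, hF⟩
    obtain ⟨h, hhs, hmax⟩ := s.exists_max_image id ⟨_, hs⟩
    simp only [s, Finset.mem_filter, Finset.mem_Icc, id] at hhs hmax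
    have hhd : h < d := by
      refine lt_of_le_of_ne hhs.1.2 fun h1 => hhs.2 ?_
      rwa [h1, hGC]
    have hm' : IsMixed 𝓜 (G (h + 1)) := by
      by_contra hm'
      have := hmax (h + 1) ⟨⟨by omega, hhd⟩, hm'⟩
      omega
    have hxh : x ∈ (G h).toSet := by
      refine (toSet_subset_iff hn).2 (HG.le le_rfl hhs.1.1 hhs.1.2) ?_
      rwa [hG _ le_rfl]
    refine ⟨h, G, hhd, HG.mono hhs.1.1 le_rfl, hhs.2, hm',
      toSet_subset_component hn h𝓜 hD hhs.2 hxh hx, ?_⟩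
    rw [toSet_eq_convexHull hn] at hxh
    exact convexHull_mono Set.subset_union_left hxh
  · have hxC := (toSet_subset_iff hn).2 hFC hxF
    exact Or.inl ⟨C, hC, toSet_subset_component hn h𝓜 hD hm hxC hx, hxC⟩

/-- Every piece is convex and meets the connected set `D`: a cube is inside `D`, and a polytope
contains the face `F h` of `D`. -/
theorem isConnected_gridClassificationSet (hn : 2 ≤ n)
    (h𝓜 : ∀ p : Fin d → Fin n, 𝓜 (vert p).lo ≠ 0) (hb : IsBoundaryPointMap n ne 𝓜 b)
    {D : Set (E d)} (hD : D ∈ components n 𝓜 b) :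
    IsConnected (gridClassificationSet n 𝓜 b D) := by
  have hsub := component_subset hn h𝓜 hb hD
  have hDc := isConnected_of_mem_components hD
  obtain ⟨x₀, hx₀⟩ := hDc.nonempty
  refine ⟨⟨x₀, hsub hx₀⟩, isPreconnected_of_forall x₀ fun x hx => ?_⟩
  suffices h : ∃ s ⊆ gridClassificationSet n 𝓜 b D, x ∈ s ∧ IsPreconnected s ∧
      (D ∩ s).Nonempty by
    obtain ⟨s, h1, h2, h3, y, hyD, hys⟩ := h
    exact ⟨D ∪ s, Set.union_subset hsub h1, Or.inl hx₀, Or.inr h2,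
      hDc.isPreconnected.union y hyD hys h3⟩
  rcases (mem_gridClassificationSet hn h𝓜 hb hD).1 hx with
    ⟨C, hC, hCD, hx⟩ | ⟨h, F, hh, HF, hFh, hm, hFD, hx⟩
  · exact ⟨C.toSet, hCD.trans hsub, hx, C.convex_toSet.isPreconnected, x, hCD hx, hx⟩
  · refine ⟨_, fun y hy => ?_, hx, (convex_convexHull ℝ _).isPreconnected, (F h).lo,
      hFD ((F h).lo_mem hn), ?_⟩
    · exact (mem_gridClassificationSet hn h𝓜 hb hD).2
        (Or.inr ⟨h, F, hh, HF, hFh, hm, hFD, hy⟩)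
    · have := (F h).lo_mem hn
      rw [toSet_eq_convexHull hn] at this
      exact convexHull_mono Set.subset_union_left this

theorem exists_mem_gridClassificationSet (hn : 2 ≤ n)
    (h𝓜 : ∀ p : Fin d → Fin n, 𝓜 (vert p).lo ≠ 0) (hb : IsBoundaryPointMap n ne 𝓜 b) {x : E d}
    (hx : x ∈ X d) : ∃ D ∈ components n 𝓜 b, x ∈ gridClassificationSet n 𝓜 b D := by
  obtain ⟨F, hF⟩ := exists_mem_relint hn hx
  obtain ⟨C, hC, hFC⟩ := exists_cube_ge hn F
  have hxC := (toSet_subset_iff hn).2 hFC (relint_subset hn F hF)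
  by_cases hm : IsMixed 𝓜 C
  · obtain ⟨h, hh, G, HG, -, h1, h2, h3⟩ := exists_mem_polytope hn (N := IsMixed 𝓜)
      (fun F hF => centre_mem_relint hn h𝓜 hb hF) (fun F => not_isMixed_of_dim_eq_zero) C hm hxC
    rw [hC] at hh HG h3
    obtain ⟨D, hD, hGD⟩ := exists_component (b := b) hn h𝓜 h1
    exact ⟨D, hD, (mem_gridClassificationSet hn h𝓜 hb hD).2
      (Or.inr ⟨h, G, hh, HG, h1, h2, hGD, h3⟩)⟩
  · obtain ⟨D, hD, hCD⟩ := exists_component (b := b) hn h𝓜 hm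
    exact ⟨D, hD, (mem_gridClassificationSet hn h𝓜 hb hD).2 (Or.inl ⟨C, hC, hCD, hxC⟩)⟩

/-! ### The resistar as the interface of the classification sets -/

/-- A mixed face contains a mixed edge, from which the chain can be prolonged downwards; the hull is
then a face of a simplex of the resistar. -/
theorem centreHull_subset_gridResistar (hd : 1 ≤ d) (hn : 2 ≤ n)
    (h𝓜 : ∀ p : Fin d → Fin n, 𝓜 (vert p).lo ≠ 0) {l : ℕ} {F : ℕ → GridFace d n}
    (HF : GridFace.IsChain l d F) (hl : l ≤ d) (hm : IsMixed 𝓜 (F l)) :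
    centreHull (centre 𝓜 b) F l d ⊆ gridResistar n 𝓜 b := by
  obtain ⟨e, heF, he, hme⟩ := hm.exists_edge h𝓜
  have hl1 : 1 ≤ l := by
    have := dim_le heF
    rwa [he, HF.1 l le_rfl hl] at this
  obtain ⟨G, HG, hGF, hG⟩ := (isChain_const e).exists_extend le_rfl heF
  rw [he] at HG hG
  rw [HF.1 l le_rfl hl] at HG hGF
  let H : ℕ → GridFace d n := fun i => if i ≤ l then G i else F i
  have HH : GridFace.IsChain 1 d H := by
    refine ⟨fun i hi hi' => ?_, fun i hi hi' => ?_⟩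
    · simp only [H]
      split_ifs with h
      · exact HG.1 i hi h
      · exact HF.1 i (by omega) hi'
    · rcases lt_trichotomy i l with h | rfl | h
      · simp only [H, if_pos h.le, if_pos (Nat.succ_le_of_lt h)]
        exact HG.2 i hi h
      · simp only [H, if_pos le_rfl, if_neg (Nat.not_succ_le_self _), hGF]
        exact HF.2 _ le_rfl hi'
      · simp only [H, if_neg (not_le.2 h), if_neg (by omega : ¬ i + 1 ≤ l)]
        exact HF.2 i h.le hi'
  intro x hx
  refine (mem_gridResistar hd hn h𝓜).2 ⟨H, HH, ?_, ?_⟩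
  · simp only [H, if_pos hl1, hG 1 le_rfl]
    exact hme
  · refine centreHull_mono _ _ hl1 le_rfl ((centreHull_congr _ fun i hi => ?_).subset hx)
    rcases hi.1.eq_or_lt with rfl | h
    · simp only [H, if_pos le_rfl, hGF]
    · simp only [H, if_neg (not_le.2 h)]

/-- A polytope is the join of `F h` with a hull of centres. Zero weight on `F h` puts the point on
the resistar; positive weight makes it retract to its component in `F h`. -/
theorem mem_gridResistar_or_retracts (hd : 1 ≤ d) (hn : 2 ≤ n)
    (h𝓜 : ∀ p : Fin d → Fin n, 𝓜 (vert p).lo ≠ 0) (hb : IsBoundaryPointMap n ne 𝓜 b)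
    {D : Set (E d)} (hD : D ∈ components n 𝓜 b) {x : E d}
    (hx : x ∈ gridClassificationSet n 𝓜 b D) :
    x ∈ gridResistar n 𝓜 b ∨
      ∃ y ∈ D, Retracts (IsMixed 𝓜 (n := n)) (centre 𝓜 b) x y := by
  rcases (mem_gridClassificationSet hn h𝓜 hb hD).1 hx with
    ⟨C, hC, hCD, hx⟩ | ⟨h, F, hh, HF, hFh, hm, hFD, hx⟩
  · exact Or.inr ⟨x, hCD hx, .terminal
      (not_isMixed_of_subset hn h𝓜 hb (hCD.trans (components_subset hD))) hx⟩
  · rw [convexHull_union ⟨_, mem_vertices.2 ⟨_, vert_base_le (F h), rfl⟩⟩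
      ((Set.nonempty_Icc.2 hh).image _), ← toSet_eq_convexHull hn, mem_convexJoin] at hx
    obtain ⟨y, hy, r, hr, s, t, hs, ht, hst, rfl⟩ := hx
    have HF' := HF.mono (Nat.le_succ h) le_rfl
    rcases hs.eq_or_lt with rfl | hs
    · left
      have ht1 : t = 1 := by linarith
      subst ht1
      rw [zero_smul, one_smul, zero_add]
      exact centreHull_subset_gridResistar hd hn h𝓜 HF' hh hm hr
    · right
      rw [add_comm]
      exact ⟨y, hFD hy, .of_mem_join hn (fun F hF => centre_mem_relint hn h𝓜 hb hF) HF
        (isMixed_of_isChain HF' hm) hy hFh hr hs ht (by linarith)⟩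

theorem gridResistar_retracts (hd : 1 ≤ d) (hn : 2 ≤ n)
    (h𝓜 : ∀ p : Fin d → Fin n, 𝓜 (vert p).lo ≠ 0) (hb : IsBoundaryPointMap n ne 𝓜 b) {x : E d}
    (hx : x ∈ gridResistar n 𝓜 b) :
    ∃ y ∉ emptyFaces n 𝓜 b, Retracts (IsMixed 𝓜 (n := n)) (centre 𝓜 b) x y := by
  obtain ⟨F, HF, hm, hxF⟩ := (mem_gridResistar hd hn h𝓜).1 hx
  obtain ⟨G, hG, h⟩ := Retracts.of_mem_centreHull hn (N := IsMixed 𝓜)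
    (fun F hF => centre_mem_relint hn h𝓜 hb hF) HF (isMixed_of_isChain HF hm) hxF
  refine ⟨_, fun hmem => ?_, h⟩
  obtain ⟨H, hH, hGH⟩ := (mem_emptyFaces hn h𝓜).1 hmem
  exact hH (hG.mono (le_of_mem_relint hn (centre_mem_relint hn h𝓜 hb hG) hGH))

theorem retracts_unique (hn : 2 ≤ n) (h𝓜 : ∀ p : Fin d → Fin n, 𝓜 (vert p).lo ≠ 0)
    (hb : IsBoundaryPointMap n ne 𝓜 b) {x y z : E d}
    (hy : Retracts (IsMixed 𝓜 (n := n)) (centre 𝓜 b) x y)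
    (hz : Retracts (IsMixed 𝓜 (n := n)) (centre 𝓜 b) x z) : y = z :=
  hy.unique hn (fun _ hF => centre_mem_relint hn h𝓜 hb hF) (fun _ _ h => IsMixed.mono h) hz

/-- The union of the resistar and the other classification sets is closed and misses `x`, because a
common point off the resistar would retract into two disjoint components. By the covering property,
a neighbourhood of `x` is left to `D`. -/
theorem mem_interior_of_notMem_gridResistar (hd : 1 ≤ d) (hn : 2 ≤ n)
    (h𝓜 : ∀ p : Fin d → Fin n, 𝓜 (vert p).lo ≠ 0) (hb : IsBoundaryPointMap n ne 𝓜 b)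
    {D : Set (E d)} (hD : D ∈ components n 𝓜 b) {x : E d}
    (hx : x ∈ gridClassificationSet n 𝓜 b D) (hR : x ∉ gridResistar n 𝓜 b)
    (hX : x ∈ interior (X d)) : x ∈ interior (gridClassificationSet n 𝓜 b D) := by
  have hclosed : IsClosed (gridResistar n 𝓜 b ∪
      ⋃ D' ∈ components n 𝓜 b \ {D}, gridClassificationSet n 𝓜 b D') :=
    (isClosed_gridResistar hd hn h𝓜).union
      (((finite_components hn h𝓜).subset Set.sdiff_subset).isClosed_biUnion fun D' hD' =>
        isClosed_gridClassificationSet hn h𝓜 hb hD'.1)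
  have hnot : x ∉ gridResistar n 𝓜 b ∪
      ⋃ D' ∈ components n 𝓜 b \ {D}, gridClassificationSet n 𝓜 b D' := by
    rintro (h | h)
    · exact hR h
    · simp only [Set.mem_iUnion] at h
      obtain ⟨D', ⟨hD', hne⟩, hx'⟩ := h
      obtain ⟨y, hy, hxy⟩ := (mem_gridResistar_or_retracts hd hn h𝓜 hb hD hx).resolve_left hR
      obtain ⟨z, hz, hxz⟩ := (mem_gridResistar_or_retracts hd hn h𝓜 hb hD' hx').resolve_left hR
      have hyz := retracts_unique hn h𝓜 hb hxy hxz
      subst hyz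
      exact hne ((eq_connectedComponentIn hD' hz).trans (eq_connectedComponentIn hD hy).symm)
  rw [mem_interior_iff_mem_nhds] at hX ⊢
  filter_upwards [hX, hclosed.isOpen_compl.mem_nhds hnot] with z hz hz'
  obtain ⟨D', hD', hzD'⟩ := exists_mem_gridClassificationSet hn h𝓜 hb hz
  by_cases h : D' = D
  · rwa [← h]
  · exact absurd (Or.inr (Set.mem_biUnion (Set.mem_sdiff_singleton.2 ⟨hD', h⟩) hzD')) hz'

/-- Points of the segment from `x` to a vertex `r` of the mixed edge `F 1`, other than `x`, retract
to `r`. When `r` is outside `D` they are neither on the resistar nor in the classification set, and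
they accumulate at `x`. -/
theorem notMem_interior_of_mem_gridResistar (hd : 1 ≤ d) (hn : 2 ≤ n)
    (h𝓜 : ∀ p : Fin d → Fin n, 𝓜 (vert p).lo ≠ 0) (hb : IsBoundaryPointMap n ne 𝓜 b)
    {D : Set (E d)} (hD : D ∈ components n 𝓜 b) {x : E d} (hR : x ∈ gridResistar n 𝓜 b) :
    x ∉ interior (gridClassificationSet n 𝓜 b D) := by
  obtain ⟨F, HF, hm, hxF⟩ := (mem_gridResistar hd hn h𝓜).1 hR
  obtain ⟨r, hr, hrD⟩ : ∃ r, vert r ≤ F 1 ∧ (vert r).lo ∉ D := by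
    obtain ⟨p, q, hp, hq, h1, h2⟩ := hm
    by_contra! hcon
    exact component_sign hn h𝓜 hD (hcon p hp) (hcon q hq) h1 h2
  have hr0 : ¬ IsMixed 𝓜 (vert r) := not_isMixed_of_dim_eq_zero rfl
  -- The vertex is put at index 0, below the mixed edge, so that `Retracts.of_mem_join` applies with
  -- `h = 0`.
  have HG := HF.update (i := 0) (G := vert r) rfl (by omega) fun _ => hr
  have HG0 : GridFace.IsChain 0 d (Function.update F 0 (vert r)) := by
    refine ⟨fun i _ hi => ?_, fun i _ hi => ?_⟩
    · rcases Nat.eq_zero_or_pos i with rfl | h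
      · simp [GridFace.dim]
      · exact HG.1 i h hi
    · rcases Nat.eq_zero_or_pos i with rfl | h
      · simpa using hr
      · exact HG.2 i h hi
  intro hint
  have hcont : Filter.Tendsto (fun s : ℝ => (1 - s) • x + s • (vert r).lo)
      (nhdsWithin 0 (Set.Ioc 0 1)) (nhds x) := by
    have h : Continuous fun s : ℝ => (1 - s) • x + s • (vert r).lo := by fun_prop
    have h' := h.tendsto 0
    simp only [sub_zero, one_smul, zero_smul, add_zero] at h'
    exact h'.mono_left nhdsWithin_le_nhds
  have hev := hcont.eventually (mem_interior_iff_mem_nhds.1 hint)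
  have hne : (nhdsWithin (0 : ℝ) (Set.Ioc 0 1)).NeBot := by
    rw [← mem_closure_iff_nhdsWithin_neBot, closure_Ioc (by norm_num)]
    simp
  obtain ⟨s, hsK, hs0, hs1⟩ := (hev.and self_mem_nhdsWithin).exists
  have hret : Retracts (IsMixed 𝓜 (n := n)) (centre 𝓜 b)
      ((1 - s) • x + s • (vert r).lo) (vert r).lo := by
    refine Retracts.of_mem_join hn (fun F hF => centre_mem_relint hn h𝓜 hb hF) HG0 ?_ ?_ ?_ ?_ hs0
      (by linarith) (by ring)
    · intro i hi
      rw [Function.update_of_ne (by have := hi.1; omega)]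
      exact isMixed_of_isChain HF hm i (by simpa using hi)
    · rw [Function.update_self]
      exact lo_mem hn _
    · rwa [Function.update_self]
    · refine (centreHull_congr _ fun i hi => ?_).subset hxF
      rw [Function.update_of_ne (by have := hi.1; omega)]
  rcases mem_gridResistar_or_retracts hd hn h𝓜 hb hD hsK with h | ⟨y, hy, h⟩
  · obtain ⟨y, hy, h⟩ := gridResistar_retracts hd hn h𝓜 hb h
    rw [retracts_unique hn h𝓜 hb h hret] at hy
    exact hy (toSet_subset_emptyFaces hn h𝓜 hr0 (lo_mem hn _))
  · rw [retracts_unique hn h𝓜 hb h hret] at hy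
    exact hrD hy

end CResistar

end

theorem mainTheorem7 (d n ne : ℕ) (hd : 1 ≤ d) (hn : 2 ≤ n) (hne : 1 ≤ ne)
    (𝓜 : CResistar.E d → SignType)
    (h𝓜 : ∀ F : CResistar.GridFace d n, ∀ v ∈ F.vertices, 𝓜 v ≠ 0)
    (b : CResistar.E d → CResistar.E d → CResistar.E d)
    (hb : CResistar.IsBoundaryPointMap n ne 𝓜 b)
    (D : Set (CResistar.E d)) (hD : D ∈ CResistar.components n 𝓜 b) :
    D ⊆ CResistar.gridClassificationSet n 𝓜 b D ∧
    IsConnected (CResistar.gridClassificationSet n 𝓜 b D) ∧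
    frontier (CResistar.gridClassificationSet n 𝓜 b D) ∩
        (CResistar.X d \ frontier (CResistar.X d)) =
      CResistar.gridClassificationSet n 𝓜 b D ∩
        (CResistar.gridResistar n 𝓜 b \ CResistar.gridResistarBoundary n 𝓜 b) := by
  have hv : ∀ p : Fin d → Fin n, 𝓜 (CResistar.GridFace.vert p).lo ≠ 0 := fun p =>
    h𝓜 (CResistar.GridFace.vert p) _ fun _ => Or.inl rfl
  refine ⟨CResistar.component_subset hn hv hb hD,
    CResistar.isConnected_gridClassificationSet hn hv hb hD, ?_⟩
  have hcl := CResistar.isClosed_gridClassificationSet hn hv hb hD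
  rw [hcl.frontier_eq]
  ext x
  constructor
  · rintro ⟨⟨hxK, hxi⟩, hxX⟩
    have hX : x ∈ interior (CResistar.X d) := by rwa [← self_sdiff_frontier]
    refine ⟨hxK, ?_, fun h =>
      CResistar.notMem_interior_of_mem_gridResistarBoundary hd hn hv hb h hxX⟩
    by_contra hR
    exact hxi (CResistar.mem_interior_of_notMem_gridResistar hd hn hv hb hD hxK hR hX)
  · rintro ⟨hxK, hxR, hxB⟩
    refine ⟨⟨hxK, CResistar.notMem_interior_of_mem_gridResistar hd hn hv hb hD hxR⟩, ?_⟩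
    by_contra hX
    exact hxB (CResistar.mem_gridResistarBoundary hd hn hv hb hxR hX)
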